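/- Let $0<q<1$, $a<0$, let $n\ge 2$ be an integer, and let $\alpha\in\mathbb R\setminus[a,1]$. Write $[n]_q=\frac{1-q^n}{1-q}$, $(c;q)_k=\prod_{j=0}^{k-1}(1-cq^j)$, $(c;q)_\infty=\prod_{j=0}^{\infty}(1-cq^j)$ and $(\mathcal D_qf)(x)=\frac{f(qx)-f(x)}{(q-1)x}$ for $x\ne0$, $(\mathcal D_qf)(0)=f'(0)$. Let $$U_k(x)=U_k^{(a)}(x;q)=(-a)^kq^{\binom k2}\,{}_2\phi_1(q^{-k},x^{-1};0;q,a^{-1}qx)=(-a)^kq^{\binom k2}\sum_{j=0}^{k}\frac{(q^{-k};q)_j}{(q;q)_j}(a^{-1}q)^j\prod_{i=0}^{j-1}(x-q^i)$$ be the monic Al-Salam–Carlitz I polynomials, which are orthogonal with respect to $$\langle\mathbf u,p\rangle=\int_a^1p(x)\,(qx;q)_\infty(a^{-1}qx;q)_\infty\,d_qx,\qquad \int_a^1f(x)\,d_qx=(1-q)\sum_{m\ge0}f(q^m)q^m-a(1-q)\sum_{m\ge0}f(aq^m)q^m.$$ For $i,j\ge0$ put $$\mathcal K_{q,n}^{(i,j)}(x,y)=\sum_{k=0}^{n-1}\frac{(\mathcal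 D_q^iU_k)(x)\,(\mathcal D_q^jU_k)(y)}{\langle\mathbf u,U_k^2\rangle}.$$ For $N\ge0$ let $U_n^{(a,\alpha)}(N;x;q)$ be the monic polynomial of degree $n$ that is orthogonal to all polynomials of degree less than $n$ with respect to the inner product $\langle f,g\rangle_S=\langle\mathbf u,fg\rangle+N(\mathcal D_qf)(\alpha)(\mathcal D_qg)(\alpha)$. This polynomial exists and is unique, and its zeros $\eta_{n,1}<\dots<\eta_{n,n}$ are real and simple. For $\tau\in\{a,1\}$ put $$N_0(\tau)=\left(\frac{[n]_q\,U_{n-1}(\alpha)}{U_n(\tau)}\,\mathcal K_{q,n}^{(0,1)}(\tau,\alpha)-\mathcal K_{q,n}^{(1,1)}(\alpha,\alpha)\right)^{-1}.$$ (i) If $\alpha<a$, then $N_0=N_0(a)>0$, and for every $N\ge0$ the smallest zero satisfies $a<\eta_{n,1}<1$ if $N<N_0$, $\eta_{n,1}=a$ if $N=N_0$, and $\eta_{n,1}<a$ if $N>N_0$. (ii) If $\alpha>1$, then $N_0=N_0(1)>0$, and for every $N\ge0$ the largest zero satisfies $a<\eta_{n,n}<1$ if $N<N_0$, $\eta_{n,n}=1$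 if $N=N_0$, and $\eta_{n,n}>1$ if $N>N_0$. -/

import Mathlib

open Polynomial

noncomputable section

/-- The `q`-number `[n]_q = (1 - q^n) / (1 - q)`. -/
def qNumber (q : ℝ) (n : ℕ) : ℝ := (1 - q ^ n) / (1 - q)

/-- The finite `q`-shifted factorial `(c; q)_k`. -/
def qPochhammer (c q : ℝ) (k : ℕ) : ℝ := ∏ j ∈ Finset.range k, (1 - c * q ^ j)

/-- The infinite `q`-shifted factorial `(c; q)_∞`. -/
def qPochhammerInf (c q : ℝ) : ℝ := ∏' j : ℕ, (1 - c * q ^ j)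

/-- The basic hypergeometric series `₂φ₁(A, B; C; q, z)`. -/
def basicHypergeometric21 (A B C q z : ℝ) : ℝ :=
  ∑' k : ℕ, qPochhammer A q k * qPochhammer B q k / qPochhammer C q k * (z ^ k / qPochhammer q q k)

/-- The Euler–Jackson `q`-derivative. -/
def qDeriv (q : ℝ) (f : ℝ → ℝ) (x : ℝ) : ℝ :=
  if x ≠ 0 ∧ q ≠ 1 then (f (q * x) - f x) / ((q - 1) * x) else deriv f x

/-- The Jackson `q`-integral `∫_0^b f(t) d_q t`, for `b` of either sign. -/
def jacksonIntegralZero (q : ℝ) (f : ℝ → ℝ) (b : ℝ) : ℝ :=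
  b * (1 - q) * ∑' k : ℕ, f (q ^ k * b) * q ^ k

/-- The Jackson `q`-integral `∫_a^b f(t) d_q t`. -/
def jacksonIntegral (q : ℝ) (f : ℝ → ℝ) (a b : ℝ) : ℝ :=
  jacksonIntegralZero q f b - jacksonIntegralZero q f a

/-- The Al-Salam–Carlitz I polynomial
`U_n^{(a)}(x; q) = (-a)^n q^{n(n-1)/2} ₂φ₁(q^{-n}, x^{-1}; 0; q, a^{-1} q x)`,
written as a polynomial by means of `(x^{-1}; q)_k x^k = ∏_{j < k} (x - q^j)`. -/
def asciPoly (q a : ℝ) (n : ℕ) : ℝ[X] :=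
  C ((-a) ^ n * q ^ n.choose 2) *
    ∑ k ∈ Finset.range (n + 1),
      C (qPochhammer (q ^ n)⁻¹ q k / qPochhammer q q k * (a⁻¹ * q) ^ k) *
        ∏ j ∈ Finset.range k, (X - C (q ^ j))

/-- The polynomial `asciPoly` is given by the hypergeometric series. -/
theorem asciPoly_eval_eq_hypergeometric (q a : ℝ) (hq : q ≠ 0) (n : ℕ) (x : ℝ) (hx : x ≠ 0) :
    (asciPoly q a n).eval x = (-a) ^ n * q ^ n.choose 2 *
      basicHypergeometric21 (q ^ n)⁻¹ x⁻¹ 0 q (a⁻¹ * q * x) := by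
  have h0 : ∀ k, n < k → qPochhammer (q ^ n)⁻¹ q k = 0 := by
    intro k hk
    refine Finset.prod_eq_zero (Finset.mem_range.2 hk) ?_
    rw [inv_mul_cancel₀ (pow_ne_zero n hq), sub_self]
  have hp : ∀ k, ∏ j ∈ Finset.range k, (x - q ^ j) = qPochhammer x⁻¹ q k * x ^ k := by
    intro k
    rw [qPochhammer, ← Finset.card_range k, ← Finset.prod_const, Finset.card_range,
      ← Finset.prod_mul_distrib]
    refine Finset.prod_congr rfl fun j _ => ?_
    field_simp
  have h1 : ∀ k, qPochhammer 0 q k = 1 := by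
    intro k
    simp [qPochhammer]
  rw [basicHypergeometric21, tsum_eq_sum (s := Finset.range (n + 1))]
  · simp only [asciPoly, eval_mul, eval_C, eval_finsetSum, eval_prod, eval_sub, eval_X, hp, h1]
    congr 1
    refine Finset.sum_congr rfl fun k _ => ?_
    rw [mul_pow _ x]
    ring
  · intro k hk
    rw [h0 k (by simpa using hk)]
    simp

/-- The Al-Salam–Carlitz I functional
`⟨u, p⟩ = ∫_a^1 p(x) (q x, a^{-1} q x; q)_∞ d_q x`. -/
def asciFunctional (q a : ℝ) (p : ℝ[X]) : ℝ :=
  jacksonIntegral q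
    (fun x => p.eval x * (qPochhammerInf (q * x) q * qPochhammerInf (a⁻¹ * q * x) q)) a 1

/-- The kernel `K_{q,n}^{(i,j)}(x, y) =
  ∑_{k < n} (D_q^i U_k)(x) (D_q^j U_k)(y) / ⟨u, U_k ^ 2⟩`. -/
def asciKernel (q a : ℝ) (n i j : ℕ) (x y : ℝ) : ℝ :=
  ∑ k ∈ Finset.range n,
    (qDeriv q)^[i] (fun t => (asciPoly q a k).eval t) x *
      (qDeriv q)^[j] (fun t => (asciPoly q a k).eval t) y /
        asciFunctional q a (asciPoly q a k ^ 2)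

/-- The Sobolev-type inner product `⟨f, g⟩_S = ⟨u, f g⟩ + N (D_q f)(α) (D_q g)(α)`. -/
def asciSobolevInner (q a α N : ℝ) (f g : ℝ[X]) : ℝ :=
  asciFunctional q a (f * g) +
    N * qDeriv q (fun t => f.eval t) α * qDeriv q (fun t => g.eval t) α

/-- `S` is the monic orthogonal polynomial of degree `n` for the Sobolev-type inner product. -/
def IsASCISobolevPoly (q a α N : ℝ) (n : ℕ) (S : ℝ[X]) : Prop :=
  S.Monic ∧ S.natDegree = n ∧
    ∀ p : ℝ[X], p.degree < (n : WithBot ℕ) → asciSobolevInner q a α N S p = 0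

/-- The threshold mass attached to the end point `τ` (which is `a` or `1`):
`([n]_q U_{n-1}(α) / U_n(τ) * K^{(0,1)}(τ, α) - K^{(1,1)}(α, α))⁻¹`. -/
def asciThreshold (q a α : ℝ) (n : ℕ) (τ : ℝ) : ℝ :=
  (qNumber q n * (asciPoly q a (n - 1)).eval α / (asciPoly q a n).eval τ *
      asciKernel q a n 0 1 τ α - asciKernel q a n 1 1 α α)⁻¹

end

/-! Write `D` for the `q`-difference quotient at `α`, `L` for the orthogonality functional, `U` for
its monic orthogonal polynomial of degree `n`, and `Q = K^{(0,1)}(·, α)`, which satisfies `L (Q p) =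
D p` for `deg p < n`. The Sobolev polynomial is then `S = U - c Q` with `c = N D U / (1 + N D Q)`,
and at the end point `b` this gives `(1 + N D Q) S(b) = U(b) (1 - N / N₀)`, where `1 / N₀ = D U ·
Q(b) / U(b) - D Q`. So the sign of `S(b)` changes exactly at `N₀`. Two facts remain, for `α > b`.

Only the last zero of `S` can reach `b`. Let `x k` be the zeros of `U` and `P = U / (X - x k)`. Then
`L (S P) = -c D P`, and also `L (S P) = (S(x k) / P(x k)) L (P²)`. No lattice point lies strictly
between `b q` and `b`, so at most one zero of `U` exceeds `b q < q α`; hence `D P > 0` by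
`qSlope_prod_pos`. The signs of `S` at the `x k` therefore alternate and the zeros interlace
(`IsSlopeKernel.exists_interlacing`).

The threshold is positive. This amounts to `V(b) < 0` for the limit `V = U - (D U / D Q) Q`, for
which `D V = 0` (`IsSlopeKernel.eval_limit_neg`). If all zeros of `V` were at most `b`, `D V = 0`
would force the top two beyond `q α > b q`, where they straddle no lattice point. Multiplying `V` by
its other linear factors would give a polynomial nonnegative on the lattice, against `L (V P) = -c D
P ≤ 0`.

The case `α < a` follows by `x ↦ -x`. The argument uses only that `L` is positive on the lattice;
the specific input is orthogonality of `asciPoly`, obtained from a raising relation and a Pearson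
equation. -/

/-- The `q`-difference quotient of a polynomial at `α`, as a linear functional. -/
noncomputable def qSlope (q α : ℝ) : ℝ[X] →ₗ[ℝ] ℝ :=
  ((q - 1) * α)⁻¹ • (leval (q * α) - leval α)

theorem qSlope_apply (q α : ℝ) (p : ℝ[X]) :
    qSlope q α p = (p.eval (q * α) - p.eval α) / ((q - 1) * α) := by
  simp [qSlope, leval_apply, div_eq_inv_mul]

/-- A functional which is positive on the nonzero polynomials that are nonnegative on the
`q`-lattice `{a q^m} ∪ {b q^m}`. -/
def PositiveOnLattice (q a b : ℝ) (L : ℝ[X] →ₗ[ℝ] ℝ) : Prop :=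
  ∀ p : ℝ[X], p ≠ 0 → (∀ m : ℕ, 0 ≤ p.eval (a * q ^ m)) → (∀ m : ℕ, 0 ≤ p.eval (b * q ^ m)) →
    0 < L p

/-- `U` is the monic orthogonal polynomial of degree `n` for the functional `L`. -/
def IsMonicOrthogonal (L : ℝ[X] →ₗ[ℝ] ℝ) (n : ℕ) (U : ℝ[X]) : Prop :=
  U.Monic ∧ U.natDegree = n ∧ ∀ p : ℝ[X], p.degree < n → L (U * p) = 0

theorem PositiveOnLattice.sq_pos {q a b : ℝ} {L : ℝ[X] →ₗ[ℝ] ℝ} (hL : PositiveOnLattice q a b L)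
    {p : ℝ[X]} (hp : p ≠ 0) : 0 < L (p * p) :=
  hL _ (mul_ne_zero hp hp) (fun m => by rw [eval_mul]; exact mul_self_nonneg _)
    (fun m => by rw [eval_mul]; exact mul_self_nonneg _)

/-- The denominator `(q - 1) α` is negative, so the product has to be smaller at `q α` than at `α`.
If every zero is at most `q α`, compare factor by factor. Otherwise exactly one zero lies in `(q α,
α)`, and the product is nonpositive at `q α` but positive at `α`. -/
theorem qSlope_prod_pos {ι : Type*} {q α : ℝ} (hq1 : q < 1) (hα : 0 < α)
    (s : Finset ι) (hs : s.Nonempty) (x : ι → ℝ) (hx : ∀ i ∈ s, x i < α)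
    (hsep : ∀ i ∈ s, ∀ j ∈ s, i ≠ j → x i ≤ q * α ∨ x j ≤ q * α) :
    0 < qSlope q α (∏ i ∈ s, (X - C (x i))) := by
  classical
  have hlt : q * α < α := by nlinarith
  have key : ∏ i ∈ s, (q * α - x i) < ∏ i ∈ s, (α - x i) := by
    by_cases h : ∀ i ∈ s, x i ≤ q * α
    · obtain ⟨i, hi⟩ := hs
      rw [← Finset.mul_prod_erase s _ hi, ← Finset.mul_prod_erase s (fun j => α - x j) hi]
      have hB : 0 < ∏ j ∈ s.erase i, (α - x j) :=
        Finset.prod_pos fun j hj => sub_pos.2 (hx j (Finset.mem_of_mem_erase hj))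
      have hAB : ∏ j ∈ s.erase i, (q * α - x j) ≤ ∏ j ∈ s.erase i, (α - x j) :=
        Finset.prod_le_prod (fun j hj => sub_nonneg.2 (h j (Finset.mem_of_mem_erase hj)))
          fun j _ => by linarith
      calc _ ≤ (q * α - x i) * ∏ j ∈ s.erase i, (α - x j) :=
            mul_le_mul_of_nonneg_left hAB (sub_nonneg.2 (h i hi))
        _ < _ := mul_lt_mul_of_pos_right (by linarith) hB
    · push Not at h
      obtain ⟨i, hi, hxi⟩ := h
      have h1 : ∏ i ∈ s, (q * α - x i) ≤ 0 := by
        rw [← Finset.mul_prod_erase s _ hi]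
        refine mul_nonpos_of_nonpos_of_nonneg (by linarith) (Finset.prod_nonneg fun j hj => ?_)
        have := hsep i hi j (Finset.mem_of_mem_erase hj) (Finset.ne_of_mem_erase hj).symm
        rcases this with h | h <;> linarith
      exact h1.trans_lt (Finset.prod_pos fun j hj => sub_pos.2 (hx j hj))
  rw [qSlope_apply, eval_prod, eval_prod]
  simp only [eval_sub, eval_X, eval_C]
  exact div_pos_of_neg_of_neg (by linarith) (by nlinarith)

/-! ### Zeros of orthogonal polynomials on a `q`-lattice, and interlacing from signs. -/

section Zeros

variable {q a b : ℝ} {L : ℝ[X] →ₗ[ℝ] ℝ} {n : ℕ} {U : ℝ[X]}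

/-- If `U = g p`, then `L (U p) = L (g p²)` is positive by lattice positivity and zero by
orthogonality. Every statement below about the location of zeros comes from a suitable `g`. -/
theorem IsMonicOrthogonal.not_dvd_of_nonneg (hU : IsMonicOrthogonal L n U)
    (hL : PositiveOnLattice q a b L) {g : ℝ[X]} (hg : 0 < g.natDegree)
    (h1 : ∀ m : ℕ, 0 ≤ g.eval (a * q ^ m)) (h2 : ∀ m : ℕ, 0 ≤ g.eval (b * q ^ m)) :
    ¬ g ∣ U := by
  rintro ⟨p, rfl⟩
  obtain ⟨hm, hn, ho⟩ := hU
  have h0 : g * p ≠ 0 := hm.ne_zero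
  have hg0 : g ≠ 0 := left_ne_zero_of_mul h0
  have hp0 : p ≠ 0 := right_ne_zero_of_mul h0
  rw [natDegree_mul hg0 hp0] at hn
  have hlt : p.degree < n := by
    rw [degree_eq_natDegree hp0]; exact_mod_cast (by omega : p.natDegree < n)
  have := hL (g * p * p) (mul_ne_zero h0 hp0)
    (fun m => by
      rw [mul_assoc, eval_mul, eval_mul]; exact mul_nonneg (h1 m) (mul_self_nonneg _))
    (fun m => by
      rw [mul_assoc, eval_mul, eval_mul]; exact mul_nonneg (h2 m) (mul_self_nonneg _))
  exact this.ne' (ho p hlt)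

theorem eval_pos_of_roots_eq_zero {g : ℝ[X]} (hg : g.Monic) (hr : g.roots = 0) (x : ℝ) :
    0 < g.eval x := by
  by_contra! h
  have hroot : ∀ y, g.eval y ≠ 0 := fun y hy => by
    have : y ∈ g.roots := (mem_roots hg.ne_zero).2 hy
    simp [hr] at this
  rcases Nat.eq_zero_or_pos g.natDegree with h0 | h0
  · rw [hg.natDegree_eq_zero.1 h0] at h
    simp at h
    linarith
  · have ht : Filter.Tendsto (fun y => g.eval y) Filter.atTop Filter.atTop :=
      g.tendsto_atTop_of_leadingCoeff_nonneg (natDegree_pos_iff_degree_pos.1 h0)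
        (by rw [hg.leadingCoeff]; exact zero_le_one)
    obtain ⟨y, hy1, hy2⟩ := ((ht.eventually_ge_atTop 0).and (Filter.eventually_ge_atTop x)).exists
    obtain ⟨z, -, hz⟩ := intermediate_value_Icc hy2 g.continuous.continuousOn ⟨h, hy1⟩
    exact hroot z hz

theorem IsMonicOrthogonal.card_roots (hU : IsMonicOrthogonal L n U)
    (hL : PositiveOnLattice q a b L) : U.roots.card = n := by
  -- `g` is the cofactor of `U` without real roots; it is positive everywhere, so it must be
  -- constant.
  obtain ⟨g, h1, h2, h3⟩ := exists_prod_multiset_X_sub_C_mul U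
  have hg : g.Monic := (monic_multisetProd_X_sub_C U.roots).of_mul_monic_left
    (by rw [h1]; exact hU.1)
  by_contra hne
  rw [hU.2.1] at h2
  exact hU.not_dvd_of_nonneg hL (g := g) (by omega)
    (fun m => (eval_pos_of_roots_eq_zero hg h3 _).le)
    (fun m => (eval_pos_of_roots_eq_zero hg h3 _).le) ⟨_, by rw [← h1, mul_comm]⟩

theorem IsMonicOrthogonal.nodup_roots (hU : IsMonicOrthogonal L n U)
    (hL : PositiveOnLattice q a b L) : U.roots.Nodup := by
  rw [Multiset.nodup_iff_count_le_one]
  intro x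
  by_contra! h
  rw [count_roots] at h
  refine hU.not_dvd_of_nonneg hL (g := (X - C x) ^ 2)
    (by rw [natDegree_pow, natDegree_X_sub_C]; simp)
    ?_ ?_ ((pow_dvd_pow _ h).trans (pow_rootMultiplicity_dvd U x)) <;>
  · intro m
    rw [eval_pow]
    exact sq_nonneg _

/-- The zeros of an orthogonal polynomial on a `q`-lattice: they are real and simple, lie strictly
between the end points, and at most one exceeds the largest but one lattice point. -/
theorem IsMonicOrthogonal.exists_zeros (hU : IsMonicOrthogonal L n U)
    (hL : PositiveOnLattice q a b L) (hq0 : 0 < q) (hq1 : q < 1) (ha : a < 0) (hb : 0 < b) :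
    ∃ x : Fin n → ℝ, StrictMono x ∧ U = ∏ k, (X - C (x k)) ∧ (∀ k, a < x k) ∧ (∀ k, x k < b) ∧
      ∀ i j, i < j → x i ≤ b * q := by
  classical
  have hcard : U.roots.toFinset.card = n := by
    rw [Multiset.toFinset_card_of_nodup (hU.nodup_roots hL), hU.card_roots hL]
  have hq : ∀ m : ℕ, 0 < q ^ m ∧ q ^ m ≤ 1 := fun m => ⟨pow_pos hq0 m, pow_le_one₀ hq0.le hq1.le⟩
  have hmem : ∀ k, U.roots.toFinset.orderEmbOfFin hcard k ∈ U.roots := fun k =>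
    Multiset.mem_toFinset.1 (Finset.orderEmbOfFin_mem _ hcard k)
  set x : Fin n → ℝ := ⇑(U.roots.toFinset.orderEmbOfFin hcard) with hx
  have hmono : StrictMono x := (U.roots.toFinset.orderEmbOfFin hcard).strictMono
  have hprod : U = ∏ k, (X - C (x k)) := by
    have h1 := prod_multiset_X_sub_C_of_monic_of_roots_card_eq hU.1
      ((hU.card_roots hL).trans hU.2.1.symm)
    have h2 : ∏ k, (X - C (x k)) = ∏ r ∈ U.roots.toFinset, (X - C r) := by
      rw [← Finset.image_orderEmbOfFin_univ U.roots.toFinset hcard,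
        Finset.prod_image (fun i _ j _ h => hmono.injective h)]
    rw [h2, Finset.prod, Multiset.toFinset_val, (hU.nodup_roots hL).dedup, h1]
  have hdvd : ∀ k, X - C (x k) ∣ U := fun k => dvd_iff_isRoot.2 (isRoot_of_mem_roots (hmem k))
  have hxb : ∀ k, x k < b := by
    intro k
    by_contra! h
    refine hU.not_dvd_of_nonneg hL (g := -(X - C (x k))) (by rw [natDegree_neg]; simp)
      (fun m => ?_) (fun m => ?_) ((neg_dvd).2 (hdvd k))
    · simp only [eval_neg, eval_sub, eval_X, eval_C]; nlinarith [hq m]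
    · simp only [eval_neg, eval_sub, eval_X, eval_C]; nlinarith [hq m]
  refine ⟨x, hmono, hprod, fun k => ?_, hxb, fun i j hij => ?_⟩
  · by_contra! h
    refine hU.not_dvd_of_nonneg hL (g := X - C (x k)) (by simp) (fun m => ?_) (fun m => ?_) (hdvd k)
    · simp only [eval_sub, eval_X, eval_C]; nlinarith [hq m]
    · simp only [eval_sub, eval_X, eval_C]; nlinarith [hq m]
  · by_contra! h
    have hlt := hmono hij
    -- This quadratic is negative only inside a gap of the lattice: both its zeros lie between `b q`
    -- and `b`.
    refine hU.not_dvd_of_nonneg hL (g := (X - C (x i)) * (X - C (x j))) ?_ (fun m => ?_)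
      (fun m => ?_) ?_
    · rw [natDegree_mul (X_sub_C_ne_zero _) (X_sub_C_ne_zero _)]; simp
    · simp only [eval_mul, eval_sub, eval_X, eval_C]
      have : a * q ^ m < 0 := mul_neg_of_neg_of_pos ha (hq m).1
      have : 0 < b * q := by positivity
      exact mul_nonneg_of_nonpos_of_nonpos (by linarith) (by linarith)
    · simp only [eval_mul, eval_sub, eval_X, eval_C]
      rcases m with _ | m
      · simp only [pow_zero, mul_one]
        exact mul_nonneg (by linarith [hxb i]) (by linarith [hxb j])
      · have : b * q ^ (m + 1) ≤ b * q := by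
          rw [pow_succ']
          exact mul_le_mul_of_nonneg_left (mul_le_of_le_one_right hq0.le (hq m).2) hb.le
        exact mul_nonneg_of_nonpos_of_nonpos (by linarith) (by linarith)
    · rw [hprod, ← Finset.mul_prod_erase _ _ (Finset.mem_univ i),
        ← Finset.mul_prod_erase _ _ (Finset.mem_erase.2 ⟨hij.ne', Finset.mem_univ j⟩), ← mul_assoc]
      exact dvd_mul_right _ _

/-- Exactly `n - 1 - k` nodes lie to the right of `x k`, and each contributes one negative factor.
-/
theorem prod_sub_sign {n : ℕ} {x : Fin n → ℝ} (hx : StrictMono x) (k : Fin n) :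
    0 < (-1) ^ (n - 1 - (k : ℕ)) * ∏ j ∈ Finset.univ.erase k, (x k - x j) := by
  have h : (Finset.univ.erase k : Finset (Fin n)) = Finset.Iio k ∪ Finset.Ioi k := by
    ext j; simp [lt_or_lt_iff_ne]
  have hd : Disjoint (Finset.Iio k) (Finset.Ioi k) := by
    rw [Finset.disjoint_left]; intro j h1 h2; simp at h1 h2; exact absurd h1 h2.not_gt
  have h2 : ∏ j ∈ Finset.Ioi k, (x k - x j) =
      (-1) ^ (n - 1 - (k : ℕ)) * ∏ j ∈ Finset.Ioi k, (x j - x k) := by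
    rw [← Fin.card_Ioi, ← Finset.prod_const, ← Finset.prod_mul_distrib]
    exact Finset.prod_congr rfl fun j _ => by ring
  rw [h, Finset.prod_union hd, h2]
  have h3 : ((-1 : ℝ) ^ (n - 1 - (k : ℕ))) * (-1) ^ (n - 1 - (k : ℕ)) = 1 := by
    rw [← mul_pow]; simp
  have h4 : 0 < (∏ j ∈ Finset.Iio k, (x k - x j)) * ∏ j ∈ Finset.Ioi k, (x j - x k) :=
    mul_pos (Finset.prod_pos fun j hj => sub_pos.2 (hx (Finset.mem_Iio.1 hj)))
      (Finset.prod_pos fun j hj => sub_pos.2 (hx (Finset.mem_Ioi.1 hj)))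
  calc _ < _ := h4
    _ = _ := by
      rw [mul_left_comm, ← mul_assoc ((-1 : ℝ) ^ (n - 1 - (k : ℕ))), h3, one_mul]

/-- A monic polynomial of degree `n` whose signs at `x 0 < ⋯ < x (n - 1)` alternate, with the
last one negative, has `n` zeros interlacing with the `x k`. -/
theorem exists_interlacing_zeros {n : ℕ} {S : ℝ[X]} (hS : S.Monic) (hn : S.natDegree = n)
    {x : Fin n → ℝ} (hx : StrictMono x)
    (h : ∀ k, S.eval (x k) * ∏ j ∈ Finset.univ.erase k, (x k - x j) < 0) :
    ∃ η : Fin n → ℝ, StrictMono η ∧ S = ∏ k, (X - C (η k)) ∧ (∀ k, x k < η k) ∧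
      ∀ k j, k < j → η k < x j := by
  have hsign : ∀ k : Fin n, (-1) ^ (n - 1 - (k : ℕ)) * S.eval (x k) < 0 := by
    intro k
    have h1 := prod_sub_sign hx k
    have h2 := h k
    have h3 : ((-1 : ℝ) ^ (n - 1 - (k : ℕ))) * (-1) ^ (n - 1 - (k : ℕ)) = 1 := by
      rw [← mul_pow]; simp
    by_contra! h4
    have := mul_nonneg h4 h1.le
    have e : (-1) ^ (n - 1 - (k : ℕ)) * S.eval (x k) *
        ((-1) ^ (n - 1 - (k : ℕ)) * ∏ j ∈ Finset.univ.erase k, (x k - x j)) =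
        S.eval (x k) * ∏ j ∈ Finset.univ.erase k, (x k - x j) := by
      rw [mul_mul_mul_comm, h3, one_mul]
    linarith
  -- Between consecutive nodes the zero comes from the sign change; after the last node, from the
  -- negative value there and the limit `+∞`.
  have hex : ∀ k : Fin n, ∃ y, x k < y ∧ (∀ j, k < j → y < x j) ∧ S.eval y = 0 := by
    intro k
    by_cases hk : (k : ℕ) + 1 < n
    · have hlt : x k < x ⟨k + 1, hk⟩ := hx (Fin.lt_def.2 (Nat.lt_succ_self _))
      have h1 := hsign k
      have h2 := hsign ⟨k + 1, hk⟩
      have e : n - 1 - (k : ℕ) = (n - 1 - (k + 1)) + 1 := by omega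
      rw [e, pow_succ] at h1
      set ε : ℝ := (-1) ^ (n - 1 - ((k : ℕ) + 1)) with hε
      have hc : ContinuousOn (fun t => ε * S.eval t) (Set.Icc (x k) (x ⟨k + 1, hk⟩)) :=
        (continuous_const.mul S.continuous).continuousOn
      obtain ⟨y, hy, hy0⟩ := intermediate_value_Ioo' hlt.le hc
        (show (0 : ℝ) ∈ _ from ⟨h2, by linarith⟩)
      refine ⟨y, hy.1, fun j hj => hy.2.trans_le (hx.monotone (Fin.le_def.2 hj)), ?_⟩
      exact (mul_eq_zero.1 hy0).resolve_left (pow_ne_zero _ (by norm_num))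
    · have h1 := hsign k
      rw [show n - 1 - (k : ℕ) = 0 by omega, pow_zero, one_mul] at h1
      have h0 : 0 < S.natDegree := by rw [hn]; exact k.pos
      have ht : Filter.Tendsto (fun y => S.eval y) Filter.atTop Filter.atTop :=
        S.tendsto_atTop_of_leadingCoeff_nonneg (natDegree_pos_iff_degree_pos.1 h0)
          (by rw [hS.leadingCoeff]; exact zero_le_one)
      obtain ⟨z, hz1, hz2⟩ :=
        ((ht.eventually_gt_atTop 0).and (Filter.eventually_ge_atTop (x k))).exists
      obtain ⟨y, hy, hy0⟩ := intermediate_value_Ioo hz2 S.continuous.continuousOn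
        (show (0 : ℝ) ∈ _ from ⟨h1, hz1⟩)
      exact ⟨y, hy.1, fun j hj => absurd (Fin.lt_def.1 hj) (by omega), hy0⟩
  choose η h1 h2 h3 using hex
  have hmono : StrictMono η := fun i j hij => (h2 i j hij).trans (h1 j)
  refine ⟨η, hmono, ?_, h1, h2⟩
  have hPm : (∏ k, (X - C (η k))).Monic := monic_prod_X_sub_C η Finset.univ
  have hPd : (∏ k, (X - C (η k))).natDegree = n := by
    rw [natDegree_prod_of_monic _ _ fun k _ => monic_X_sub_C _]; simp
  -- Both sides are monic of degree `n`, so their difference has degree below `n` and vanishes at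
  -- the `n` points `η k`.
  refine eq_of_degree_sub_lt_of_eval_index_eq Finset.univ hmono.injective.injOn ?_ fun k _ => ?_
  · have hd : S.degree = (∏ k, (X - C (η k))).degree := by
      rw [degree_eq_natDegree hS.ne_zero, degree_eq_natDegree hPm.ne_zero, hn, hPd]
    refine (degree_sub_lt_left hd hS.ne_zero
      (by rw [hS.leadingCoeff, hPm.leadingCoeff])).trans_eq ?_
    rw [degree_eq_natDegree hS.ne_zero, hn]; simp
  · rw [h3, eval_prod, Finset.prod_eq_zero (Finset.mem_univ k)]; simp

end Zeros

/-! ### Sobolev-type modification of a functional that is positive on the lattice. -/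

/-- `Q` represents the `q`-difference quotient at `α` on polynomials of degree less than `n`. -/
def IsSlopeKernel (q α : ℝ) (L : ℝ[X] →ₗ[ℝ] ℝ) (n : ℕ) (Q : ℝ[X]) : Prop :=
  Q.degree < n ∧ ∀ p : ℝ[X], p.degree < n → L (Q * p) = qSlope q α p

/-- `S` is a monic polynomial of degree `n` orthogonal for the Sobolev-type modification of `L`
with mass `N` at `α`. -/
def IsSobolevOrthogonal (q α : ℝ) (L : ℝ[X] →ₗ[ℝ] ℝ) (N : ℝ) (n : ℕ) (S : ℝ[X]) : Prop :=
  S.Monic ∧ S.natDegree = n ∧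
    ∀ p : ℝ[X], p.degree < n → L (S * p) + N * qSlope q α S * qSlope q α p = 0

section Sobolev

variable {q a b α N : ℝ} {L : ℝ[X] →ₗ[ℝ] ℝ} {n : ℕ} {U Q S : ℝ[X]}

theorem degree_sub_lt_of_monic {S U : ℝ[X]} (hS : S.Monic) (hU : U.Monic) (hSn : S.natDegree = n)
    (hUn : U.natDegree = n) : (S - U).degree < n := by
  have hd : S.degree = U.degree := by
    rw [degree_eq_natDegree hS.ne_zero, degree_eq_natDegree hU.ne_zero, hSn, hUn]
  refine (degree_sub_lt_left hd hS.ne_zero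
    (by rw [hS.leadingCoeff, hU.leadingCoeff])).trans_eq ?_
  rw [degree_eq_natDegree hS.ne_zero, hSn]

theorem IsSlopeKernel.apply_sub_mul (hU : IsMonicOrthogonal L n U) (hQ : IsSlopeKernel q α L n Q)
    (c : ℝ) {p : ℝ[X]} (hp : p.degree < n) : L ((U - C c * Q) * p) = -(c * qSlope q α p) := by
  rw [sub_mul, map_sub, hU.2.2 p hp, mul_assoc, ← smul_eq_C_mul, map_smul, hQ.2 p hp]
  simp

theorem qSlope_sub_C_mul (q α c : ℝ) (U Q : ℝ[X]) :
    qSlope q α (U - C c * Q) = qSlope q α U - c * qSlope q α Q := by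
  rw [map_sub, ← smul_eq_C_mul, map_smul, smul_eq_mul]

theorem IsSlopeKernel.monic_sub (hU : IsMonicOrthogonal L n U) (hQ : IsSlopeKernel q α L n Q)
    (c : ℝ) : (U - C c * Q).Monic ∧ (U - C c * Q).natDegree = n := by
  have h : (C c * Q).degree < U.degree := by
    rw [degree_eq_natDegree hU.1.ne_zero, hU.2.1, ← smul_eq_C_mul]
    exact (degree_smul_le c Q).trans_lt hQ.1
  exact ⟨hU.1.sub_of_left h, by
    rw [natDegree_eq_of_degree_eq (degree_sub_eq_left_of_degree_lt h), hU.2.1]⟩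

theorem IsSlopeKernel.qSlope_nonneg (hL : PositiveOnLattice q a b L)
    (hQ : IsSlopeKernel q α L n Q) : 0 ≤ qSlope q α Q := by
  rw [← hQ.2 Q hQ.1]
  rcases eq_or_ne Q 0 with rfl | h
  · simp
  · exact (hL.sq_pos h).le

/-- `D Q = L (Q²)`, and `Q ≠ 0` because `D X = 1`; testing against `X` is where `n ≥ 2` is needed.
-/
theorem IsSlopeKernel.qSlope_pos (hL : PositiveOnLattice q a b L) (hQ : IsSlopeKernel q α L n Q)
    (hn : 2 ≤ n) (hq : q ≠ 1) (hα : α ≠ 0) : 0 < qSlope q α Q := by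
  rw [← hQ.2 Q hQ.1]
  refine hL.sq_pos ?_
  rintro rfl
  have h1 := hQ.2 X (by rw [degree_X]; exact_mod_cast hn)
  have : (q - 1) * α ≠ 0 := mul_ne_zero (sub_ne_zero.2 hq) hα
  have e : q * α - α = (q - 1) * α := by ring
  simp [qSlope_apply, e, this] at h1

/-- With `c = N D S`, both `S` and `U - c Q` pair with `p` to `-c D p`. Their difference has degree
below `n` and is orthogonal to itself, hence zero. Applying `D` to `S = U - c Q` then gives a linear
equation for `c`. -/
theorem IsSobolevOrthogonal.eq_sub (hL : PositiveOnLattice q a b L)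
    (hU : IsMonicOrthogonal L n U) (hQ : IsSlopeKernel q α L n Q) (hN : 0 ≤ N)
    (hS : IsSobolevOrthogonal q α L N n S) :
    S = U - C (N * qSlope q α U / (1 + N * qSlope q α Q)) * Q := by
  set c := N * qSlope q α S with hc
  have hR : S = U - C c * Q := by
    by_contra hne
    have h0 : S - (U - C c * Q) ≠ 0 := sub_ne_zero.2 hne
    obtain ⟨h1, h2⟩ := hQ.monic_sub hU c
    have hd := degree_sub_lt_of_monic hS.1 h1 hS.2.1 h2
    have h3 := hL.sq_pos h0
    set R := S - (U - C c * Q) with hRdef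
    have h4 : R * R = S * R - (U - C c * Q) * R := by rw [← sub_mul]
    rw [h4, map_sub, hQ.apply_sub_mul hU c hd] at h3
    linarith [hS.2.2 R hd]
  have hpos : 0 < 1 + N * qSlope q α Q := by
    have := mul_nonneg hN (hQ.qSlope_nonneg hL); linarith
  have hD : qSlope q α S = qSlope q α U - c * qSlope q α Q := by
    conv_lhs => rw [hR]
    exact qSlope_sub_C_mul _ _ _ _ _
  have hc2 : c = N * qSlope q α U / (1 + N * qSlope q α Q) := by
    rw [eq_div_iff hpos.ne', mul_add, mul_one]
    nth_rewrite 1 [hc]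
    rw [hD]; ring
  rw [← hc2]; exact hR

theorem existsUnique_isSobolevOrthogonal (hL : PositiveOnLattice q a b L)
    (hU : IsMonicOrthogonal L n U) (hQ : IsSlopeKernel q α L n Q) (hN : 0 ≤ N) :
    ∃! S, IsSobolevOrthogonal q α L N n S := by
  refine ⟨U - C (N * qSlope q α U / (1 + N * qSlope q α Q)) * Q, ?_,
    fun S hS => hS.eq_sub hL hU hQ hN⟩
  obtain ⟨h1, h2⟩ := hQ.monic_sub hU (N * qSlope q α U / (1 + N * qSlope q α Q))
  refine ⟨h1, h2, fun p hp => ?_⟩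
  have hpos : 0 < 1 + N * qSlope q α Q := by
    have := mul_nonneg hN (hQ.qSlope_nonneg hL); linarith
  rw [hQ.apply_sub_mul hU _ hp, qSlope_sub_C_mul]
  field_simp
  ring

/-- Pairing `U - c Q` with `U / (X - x k)` isolates its value at `x k`, as in Gauss quadrature,
while the kernel property fixes the sign of the pairing. -/
theorem IsSlopeKernel.exists_interlacing (hq1 : q < 1)
    (hb : 0 < b) (hα : b < α) (hL : PositiveOnLattice q a b L)
    (hU : IsMonicOrthogonal L n U) (hQ : IsSlopeKernel q α L n Q) (hn : 2 ≤ n) {x : Fin n → ℝ}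
    (hx : StrictMono x) (hxU : U = ∏ k, (X - C (x k))) (hxb : ∀ k, x k < b)
    (hxq : ∀ i j, i < j → x i ≤ q * α) {c : ℝ} (hc : 0 < c) :
    ∃ η : Fin n → ℝ, StrictMono η ∧ U - C c * Q = ∏ k, (X - C (η k)) ∧ (∀ k, x k < η k) ∧
      ∀ k j, k < j → η k < x j := by
  obtain ⟨h1, h2⟩ := hQ.monic_sub hU c
  refine exists_interlacing_zeros h1 h2 hx fun k => ?_
  set S := U - C c * Q with hS
  set P : ℝ[X] := ∏ j ∈ Finset.univ.erase k, (X - C (x j)) with hP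
  have hPm : P.Monic := monic_prod_X_sub_C x _
  have hUP : U = (X - C (x k)) * P := by
    rw [hxU, hP, Finset.mul_prod_erase _ (fun j => X - C (x j)) (Finset.mem_univ k)]
  have hPd : P.natDegree = n - 1 := by
    rw [hP, natDegree_prod_of_monic _ _ fun k _ => monic_X_sub_C _]; simp
  have hPlt : P.degree < n := by
    rw [degree_eq_natDegree hPm.ne_zero, hPd]; exact_mod_cast (by omega : n - 1 < n)
  have hPe : P.eval (x k) = ∏ j ∈ Finset.univ.erase k, (x k - x j) := by
    rw [hP, eval_prod]; simp
  have hP0 : P.eval (x k) ≠ 0 := by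
    rw [hPe, Finset.prod_ne_zero_iff]
    intro j hj
    exact sub_ne_zero.2 (hx.injective.ne (Finset.ne_of_mem_erase hj).symm)
  have hD : 0 < qSlope q α P := by
    refine qSlope_prod_pos hq1 (hb.trans hα) _ ?_ x (fun i _ => (hxb i).trans hα) ?_
    · rw [← Finset.card_pos, Finset.card_erase_of_mem (Finset.mem_univ _)]; simp; omega
    · intro i _ j _ hij
      rcases hij.lt_or_gt with h | h
      · exact Or.inl (hxq i j h)
      · exact Or.inr (hxq j i h)
  have hneg : L (S * P) < 0 := by
    rw [hS, hQ.apply_sub_mul hU c hPlt]; linarith [mul_pos hc hD]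
  set r := S.eval (x k) / P.eval (x k) with hr
  -- `r` is chosen so that `S - r P` vanishes at `x k`. Then `(S - r P) P = U T` with `deg T < n`,
  -- and `L` kills this product.
  obtain ⟨T, hT⟩ : X - C (x k) ∣ S - C r * P := by
    rw [dvd_iff_isRoot, IsRoot, eval_sub, eval_mul, eval_C, hr, div_mul_cancel₀ _ hP0, sub_self]
  have hTd : T.degree < n := by
    have hle : (S - C r * P).natDegree ≤ n := by
      refine (natDegree_sub_le _ _).trans (max_le h2.le ((natDegree_C_mul_le _ _).trans ?_))
      omega
    rcases eq_or_ne T 0 with h0 | h0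
    · rw [h0, degree_zero]; exact WithBot.bot_lt_coe _
    · rw [hT, natDegree_mul (X_sub_C_ne_zero _) h0, natDegree_X_sub_C] at hle
      rw [degree_eq_natDegree h0]; exact_mod_cast (by omega : T.natDegree < n)
  have hLr : L (S * P) = r * L (P * P) := by
    have e : S * P = U * T + r • (P * P) := by
      rw [hUP, smul_eq_C_mul, ← sub_eq_iff_eq_add]
      linear_combination P * hT
    rw [e, map_add, hU.2.2 T hTd, map_smul, zero_add, smul_eq_mul]
  have hr0 : r < 0 := by
    by_contra! h
    have := mul_nonneg h (hL.sq_pos hPm.ne_zero).le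
    linarith
  rw [← hPe]
  have e : S.eval (x k) * P.eval (x k) = r * (P.eval (x k) * P.eval (x k)) := by
    rw [hr, ← mul_assoc, div_mul_cancel₀ _ hP0]
  rw [e]
  exact mul_neg_of_neg_of_pos hr0 (mul_self_pos.2 hP0)

theorem qSlope_pos_of_zeros (hq1 : q < 1)
    (hb : 0 < b) (hα : b < α) (hn : 2 ≤ n) {x : Fin n → ℝ}
    (hxU : U = ∏ k, (X - C (x k))) (hxb : ∀ k, x k < b)
    (hxq : ∀ i j, i < j → x i ≤ q * α) : 0 < qSlope q α U := by
  rw [hxU]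
  refine qSlope_prod_pos hq1 (hb.trans hα) _ ⟨⟨0, by omega⟩, Finset.mem_univ _⟩ x
    (fun i _ => (hxb i).trans hα) fun i _ j _ hij => ?_
  rcases hij.lt_or_gt with h | h
  · exact Or.inl (hxq i j h)
  · exact Or.inr (hxq j i h)

/-- The limit of the Sobolev polynomials as the mass tends to infinity has a zero beyond the end
point. -/
theorem IsSlopeKernel.eval_limit_neg (hq0 : 0 < q) (hq1 : q < 1) (ha : a < 0)
    (hb : 0 < b) (hα : b < α) (hL : PositiveOnLattice q a b L)
    (hU : IsMonicOrthogonal L n U) (hQ : IsSlopeKernel q α L n Q) (hn : 2 ≤ n) {x : Fin n → ℝ}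
    (hx : StrictMono x) (hxU : U = ∏ k, (X - C (x k))) (hxb : ∀ k, x k < b)
    (hxq : ∀ i j, i < j → x i ≤ b * q) :
    (U - C (qSlope q α U / qSlope q α Q) * Q).eval b < 0 := by
  have hqα : b * q < q * α := by nlinarith
  have hxq' : ∀ i j, i < j → x i ≤ q * α := fun i j h => (hxq i j h).trans hqα.le
  have hα0 : 0 < α := hb.trans hα
  have hDU := qSlope_pos_of_zeros hq1 hb hα hn hxU hxb hxq'
  have hDQ := hQ.qSlope_pos hL hn hq1.ne hα0.ne'
  set c := qSlope q α U / qSlope q α Q with hc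
  have hc0 : 0 < c := div_pos hDU hDQ
  obtain ⟨y, hy, hV, hxy, hyx⟩ := hQ.exists_interlacing hq1 hb hα hL hU hn hx hxU hxb hxq' hc0
  have hDV : qSlope q α (U - C c * Q) = 0 := by
    rw [qSlope_sub_C_mul, hc, div_mul_cancel₀ _ hDQ.ne', sub_self]
  obtain ⟨m, rfl⟩ : ∃ m, n = m + 2 := ⟨n - 2, by omega⟩
  rw [hV, Fin.prod_univ_castSucc, eval_mul, eval_prod]
  simp only [eval_sub, eval_X, eval_C]
  have hyb : ∀ k : Fin (m + 1), y k.castSucc < b := fun k =>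
    (hyx k.castSucc (Fin.last _) (Fin.castSucc_lt_last k)).trans (hxb _)
  refine mul_neg_of_pos_of_neg (Finset.prod_pos fun k _ => sub_pos.2 (hyb k)) ?_
  by_contra! hlast
  have hyle : ∀ k, y k ≤ b := fun k => (hy.monotone (Fin.le_last k)).trans (by linarith)
  have hyα : ∀ k, y k < α := fun k => (hyle k).trans_lt hα
  -- If the last zero but one were at most `q α`, then `qSlope_prod_pos` would make the slope of
  -- this polynomial positive, whereas it is zero.
  have hpen : q * α < y (Fin.last m).castSucc := by
    by_contra! h
    have : 0 < qSlope q α (∏ k, (X - C (y k))) := by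
      have hs : ∀ i j, i < j → y i ≤ q * α := fun i j hij => by
        refine (hy.monotone ?_).trans h
        rw [Fin.le_def]; have := Fin.lt_def.1 hij; have := j.isLt; simp; omega
      refine qSlope_prod_pos hq1 hα0 _ ⟨0, Finset.mem_univ _⟩ y
        (fun i _ => hyα i) fun i _ j _ hij => ?_
      rcases hij.lt_or_gt with h | h
      · exact Or.inl (hs i j h)
      · exact Or.inr (hs j i h)
    rw [← hV, hDV] at this
    exact this.false
  have hlast' : q * α < y (Fin.last (m + 1)) :=
    hpen.trans (hy (Fin.castSucc_lt_last _))
  -- `P` collects all zeros but the top two, so multiplying by it leaves a square times a quadratic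
  -- whose zeros lie in `(b q, b]`.
  set P : ℝ[X] := ∏ k : Fin m, (X - C (y k.castSucc.castSucc)) with hP
  have hPm : P.Monic := monic_prod_X_sub_C _ _
  have hPd : P.natDegree = m := by
    rw [hP, natDegree_prod_of_monic _ _ fun k _ => monic_X_sub_C _]; simp
  have hPlt : P.degree < (m + 2 : ℕ) := by
    rw [degree_eq_natDegree hPm.ne_zero, hPd]; exact_mod_cast (by omega : m < m + 2)
  have hVP : U - C c * Q =
      P * ((X - C (y (Fin.last m).castSucc)) * (X - C (y (Fin.last (m + 1))))) := by
    rw [hV, Fin.prod_univ_castSucc, Fin.prod_univ_castSucc, mul_assoc]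
  have hDP : 0 ≤ qSlope q α P := by
    -- For `n = 2` the product is empty and its slope is zero; a weak inequality is all that is
    -- needed.
    rcases m with _ | m
    · simp [hP, qSlope_apply]
    · refine (qSlope_prod_pos hq1 hα0 _ ⟨0, Finset.mem_univ _⟩ _ (fun i _ => hyα _) ?_).le
      intro i _ j _ _
      left
      refine (hyx _ (Fin.last _).castSucc ?_).le.trans
        (hxq' _ (Fin.last _) (Fin.castSucc_lt_last _))
      exact Fin.castSucc_lt_castSucc_iff.2 (Fin.castSucc_lt_last i)
  have hLV := hQ.apply_sub_mul hU c hPlt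
  have hq : ∀ m : ℕ, 0 < q ^ m ∧ q ^ m ≤ 1 := fun m => ⟨pow_pos hq0 m, pow_le_one₀ hq0.le hq1.le⟩
  have hpos : 0 < L ((U - C c * Q) * P) := by
    have hbq : 0 < b * q := by positivity
    refine hL _ (mul_ne_zero (hQ.monic_sub hU c).1.ne_zero hPm.ne_zero) (fun k => ?_) fun k => ?_
    · rw [hVP, mul_right_comm, eval_mul, eval_mul, eval_mul]
      simp only [eval_sub, eval_X, eval_C]
      have : a * q ^ k < 0 := mul_neg_of_neg_of_pos ha (hq k).1
      exact mul_nonneg (mul_self_nonneg _)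
        (mul_nonneg_of_nonpos_of_nonpos (by linarith) (by linarith))
    · rw [hVP, mul_right_comm, eval_mul, eval_mul, eval_mul]
      simp only [eval_sub, eval_X, eval_C]
      refine mul_nonneg (mul_self_nonneg _) ?_
      rcases k with _ | k
      · simp only [pow_zero, mul_one]
        exact mul_nonneg (by linarith [hyle (Fin.last m).castSucc])
          (by linarith [hyle (Fin.last (m + 1))])
      · have : b * q ^ (k + 1) ≤ b * q := by
          rw [pow_succ']
          exact mul_le_mul_of_nonneg_left (mul_le_of_le_one_right hq0.le (hq k).2) hb.le
        exact mul_nonneg_of_nonpos_of_nonpos (by linarith) (by linarith)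
  rw [hLV] at hpos
  linarith [mul_nonneg hc0.le hDP]

/-- The critical mass at the end point `b`. -/
noncomputable def criticalMass (q α : ℝ) (U Q : ℝ[X]) (b : ℝ) : ℝ :=
  (qSlope q α U / U.eval b * Q.eval b - qSlope q α Q)⁻¹

/-- Location of the largest zero of the Sobolev polynomials, for `α` to the right. -/
theorem IsSlopeKernel.largest_zero (hq0 : 0 < q) (hq1 : q < 1) (ha : a < 0)
    (hb : 0 < b) (hα : b < α) (hL : PositiveOnLattice q a b L)
    (hU : IsMonicOrthogonal L n U) (hQ : IsSlopeKernel q α L n Q) (hn : 2 ≤ n) {l : Fin n}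
    (hl : (l : ℕ) + 1 = n) :
    0 < criticalMass q α U Q b ∧ ∀ N S, 0 ≤ N → IsSobolevOrthogonal q α L N n S →
      ∃ η : Fin n → ℝ, StrictMono η ∧ S = ∏ k, (X - C (η k)) ∧ a < η l ∧
        (N < criticalMass q α U Q b → η l < b) ∧
        (N = criticalMass q α U Q b → η l = b) ∧
        (criticalMass q α U Q b < N → b < η l) := by
  obtain ⟨x, hx, hxU, hax, hxb, hxq⟩ := hU.exists_zeros hL hq0 hq1 ha hb
  have hqα : b * q < q * α := by nlinarith
  have hxq' : ∀ i j, i < j → x i ≤ q * α := fun i j h => (hxq i j h).trans hqα.le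
  have hDU := qSlope_pos_of_zeros hq1 hb hα hn hxU hxb hxq'
  have hDQ := hQ.qSlope_pos hL hn hq1.ne (hb.trans hα).ne'
  have hUb : 0 < U.eval b := by
    rw [hxU, eval_prod]
    exact Finset.prod_pos fun k _ => by simpa using hxb k
  have hlim := hQ.eval_limit_neg hq0 hq1 ha hb hα hL hU hn hx hxU hxb hxq
  -- Multiplying the negative value of the limit polynomial at `b` by `D Q / U(b)` gives exactly
  -- minus this inverse.
  have hT : 0 < (criticalMass q α U Q b)⁻¹ := by
    rw [eval_sub, eval_mul, eval_C] at hlim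
    rw [criticalMass, inv_inv, sub_pos, div_mul_eq_mul_div, lt_div_iff₀ hUb]
    have := mul_neg_of_pos_of_neg hDQ hlim
    rw [mul_sub, ← mul_assoc, mul_div_cancel₀ _ hDQ.ne'] at this
    linarith
  have hT0 : 0 < criticalMass q α U Q b := inv_pos.1 hT
  refine ⟨hT0, fun N S hN hS => ?_⟩
  -- For `N = 0` the coefficient of `Q` vanishes and strict interlacing fails, but then `S = U`.
  rcases hN.eq_or_lt with rfl | hN
  · have : S = U := by simpa using hS.eq_sub hL hU hQ le_rfl
    exact ⟨x, hx, this.trans hxU, hax _, fun _ => hxb _, fun h => absurd h hT0.ne,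
      fun h => absurd h hT0.not_gt⟩
  have hSe := hS.eq_sub hL hU hQ hN.le
  have hden : 0 < 1 + N * qSlope q α Q := by positivity
  obtain ⟨η, hη, hSη, hxη, hηx⟩ := hQ.exists_interlacing hq1 hb hα hL hU hn hx hxU hxb hxq'
    (show 0 < N * qSlope q α U / (1 + N * qSlope q α Q) by positivity)
  rw [← hSe] at hSη
  refine ⟨η, hη, hSη, (hax _).trans (hxη _), ?_⟩
  have hSb : (1 + N * qSlope q α Q) * S.eval b =
      U.eval b * (1 - N * (criticalMass q α U Q b)⁻¹) := by
    rw [hSe, criticalMass, inv_inv, eval_sub, eval_mul, eval_C]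
    field_simp
    ring
  obtain ⟨m, rfl⟩ : ∃ m, n = m + 1 := ⟨n - 1, by omega⟩
  obtain rfl : l = Fin.last m := Fin.ext (Nat.succ_injective hl)
  have hSb2 : S.eval b = (∏ k : Fin m, (b - η k.castSucc)) * (b - η (Fin.last m)) := by
    rw [hSη, Fin.prod_univ_castSucc, eval_mul, eval_prod]; simp
  -- By interlacing all zeros but the last stay below `b`, so the sign of `S(b)` is the sign of `b -
  -- η l`.
  have hpr : 0 < ∏ k : Fin m, (b - η k.castSucc) := Finset.prod_pos fun k _ =>
    sub_pos.2 ((hηx _ (Fin.last m) (Fin.castSucc_lt_last k)).trans (hxb _))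
  rw [hSb2, ← mul_assoc] at hSb
  have hpr2 := mul_pos hden hpr
  have hkey : ∀ u v w z : ℝ, 0 < u → 0 < w → u * v = w * z →
      (0 < z → 0 < v) ∧ (z = 0 → v = 0) ∧ (z < 0 → v < 0) := by
    intro u v w z hu hw h
    refine ⟨fun hz => ?_, fun hz => ?_, fun hz => ?_⟩
    · exact pos_of_mul_pos_right (by rw [h]; positivity) hu.le
    · rw [hz, mul_zero] at h; exact (mul_eq_zero.1 h).resolve_left hu.ne'
    · exact neg_of_mul_neg_right (by rw [h]; exact mul_neg_of_pos_of_neg hw hz) hu.le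
  obtain ⟨k1, k2, k3⟩ := hkey _ _ _ _ hpr2 hUb hSb
  rw [← div_eq_mul_inv] at k1 k2 k3
  refine ⟨fun h => ?_, fun h => ?_, fun h => ?_⟩
  · linarith [k1 (by rw [sub_pos, div_lt_one hT0]; exact h)]
  · linarith [k2 (by rw [h, div_self hT0.ne', sub_self])]
  · linarith [k3 (by rw [sub_neg, one_lt_div hT0]; exact h)]

end Sobolev

/-! ### Reflection in the origin, exchanging the two end points. -/

section Reflection

variable {q a b α N : ℝ} {L : ℝ[X] →ₗ[ℝ] ℝ} {n : ℕ} {U Q S : ℝ[X]}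

/-- The reflection of a functional in the origin. -/
noncomputable def reflectFunctional (L : ℝ[X] →ₗ[ℝ] ℝ) : ℝ[X] →ₗ[ℝ] ℝ :=
  L ∘ₗ (aeval (-X : ℝ[X])).toLinearMap

theorem reflectFunctional_apply (L : ℝ[X] →ₗ[ℝ] ℝ) (p : ℝ[X]) :
    reflectFunctional L p = L (p.comp (-X)) := rfl

theorem PositiveOnLattice.reflect (hL : PositiveOnLattice q a b L) :
    PositiveOnLattice q (-b) (-a) (reflectFunctional L) := by
  intro p hp h1 h2
  rw [reflectFunctional_apply]
  refine hL _ (by simpa using hp) (fun m => ?_) fun m => ?_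
  · simpa [eval_comp] using h2 m
  · simpa [eval_comp] using h1 m

theorem monic_reflect (h : U.Monic) (hn : U.natDegree = n) :
    (C ((-1) ^ n) * U.comp (-X)).Monic ∧ (C ((-1) ^ n) * U.comp (-X)).natDegree = n := by
  have h1 := h.neg_one_pow_natDegree_mul_comp_neg_X
  rw [hn] at h1
  have e : (C ((-1) ^ n) : ℝ[X]) = (-1) ^ n := by simp
  refine ⟨by rw [e]; exact h1, ?_⟩
  rw [natDegree_C_mul (pow_ne_zero _ (by norm_num)), natDegree_comp]
  simp [hn]

theorem qSlope_reflect (q α : ℝ) (p : ℝ[X]) : qSlope q (-α) (p.comp (-X)) = -qSlope q α p := by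
  simp [qSlope_apply, eval_comp, div_neg]

theorem qSlope_C_mul (q α c : ℝ) (p : ℝ[X]) : qSlope q α (C c * p) = c * qSlope q α p := by
  rw [← smul_eq_C_mul, map_smul, smul_eq_mul]

theorem reflectFunctional_mul (L : ℝ[X] →ₗ[ℝ] ℝ) (c : ℝ) (p r : ℝ[X]) :
    reflectFunctional L (C c * p.comp (-X) * r) = c * L (p * r.comp (-X)) := by
  rw [reflectFunctional_apply, mul_comp, mul_comp, C_comp, comp_neg_X_comp_neg_X, mul_assoc,
    ← smul_eq_C_mul, map_smul, smul_eq_mul]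

theorem qSlope_eq_neg_reflect (q α : ℝ) (p : ℝ[X]) :
    qSlope q (-α) p = -qSlope q α (p.comp (-X)) := by
  rw [← qSlope_reflect, comp_neg_X_comp_neg_X]

theorem IsMonicOrthogonal.reflect (hU : IsMonicOrthogonal L n U) :
    IsMonicOrthogonal (reflectFunctional L) n (C ((-1) ^ n) * U.comp (-X)) := by
  obtain ⟨h1, h2⟩ := monic_reflect hU.1 hU.2.1
  refine ⟨h1, h2, fun p hp => ?_⟩
  rw [reflectFunctional_mul, hU.2.2 _ (by rwa [degree_comp_neg_X]), mul_zero]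

/-- The factor `-1` compensates for the sign change of the difference quotient under `x ↦ -x`. -/
theorem IsSlopeKernel.reflect (hQ : IsSlopeKernel q α L n Q) :
    IsSlopeKernel q (-α) (reflectFunctional L) n (C (-1) * Q.comp (-X)) := by
  refine ⟨?_, fun p hp => ?_⟩
  · rw [← smul_eq_C_mul]
    exact (degree_smul_le _ _).trans_lt (by rw [degree_comp_neg_X]; exact hQ.1)
  · rw [reflectFunctional_mul, hQ.2 _ (by rwa [degree_comp_neg_X]), qSlope_eq_neg_reflect]
    ring

theorem IsSobolevOrthogonal.reflect (hS : IsSobolevOrthogonal q α L N n S) :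
    IsSobolevOrthogonal q (-α) (reflectFunctional L) N n (C ((-1) ^ n) * S.comp (-X)) := by
  obtain ⟨h1, h2⟩ := monic_reflect hS.1 hS.2.1
  refine ⟨h1, h2, fun p hp => ?_⟩
  have := hS.2.2 (p.comp (-X)) (by rwa [degree_comp_neg_X])
  rw [reflectFunctional_mul, qSlope_C_mul, qSlope_reflect, qSlope_eq_neg_reflect q α p]
  linear_combination (-1) ^ n * this

theorem criticalMass_reflect (q α : ℝ) (n : ℕ) (U Q : ℝ[X]) (a : ℝ) :
    criticalMass q (-α) (C ((-1) ^ n) * U.comp (-X)) (C (-1) * Q.comp (-X)) (-a) =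
      criticalMass q α U Q a := by
  have h : ((-1 : ℝ) ^ n) ≠ 0 := pow_ne_zero _ (by norm_num)
  simp only [criticalMass, qSlope_C_mul, qSlope_reflect, eval_mul, eval_C, eval_comp, eval_neg,
    eval_X, neg_neg]
  rw [mul_div_mul_left _ _ h]
  ring

/-- Location of the smallest zero of the Sobolev polynomials, for `α` to the left. -/
theorem IsSlopeKernel.smallest_zero (hq0 : 0 < q) (hq1 : q < 1) (ha : a < 0)
    (hb : 0 < b) (hα : α < a) (hL : PositiveOnLattice q a b L)
    (hU : IsMonicOrthogonal L n U) (hQ : IsSlopeKernel q α L n Q) (hn : 2 ≤ n) {l : Fin n}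
    (hl : (l : ℕ) = 0) :
    0 < criticalMass q α U Q a ∧ ∀ N S, 0 ≤ N → IsSobolevOrthogonal q α L N n S →
      ∃ η : Fin n → ℝ, StrictMono η ∧ S = ∏ k, (X - C (η k)) ∧ η l < b ∧
        (N < criticalMass q α U Q a → a < η l) ∧
        (N = criticalMass q α U Q a → η l = a) ∧
        (criticalMass q α U Q a < N → η l < a) := by
  obtain ⟨h0, h⟩ := hQ.reflect.largest_zero hq0 hq1 (neg_lt_zero.2 hb) (neg_pos.2 ha)
    (neg_lt_neg hα) hL.reflect hU.reflect hn
    (l := l.rev) (by rw [Fin.val_rev, hl]; omega)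
  rw [criticalMass_reflect] at h0 h
  refine ⟨h0, fun N S hN hS => ?_⟩
  obtain ⟨η, hη, hSη, hb', h1, h2, h3⟩ := h N _ hN hS.reflect
  -- Negation reverses the order, so the indices are reversed as well and the largest zero becomes
  -- the smallest.
  refine ⟨fun k => -η k.rev, fun i j hij => neg_lt_neg (hη (Fin.rev_lt_rev.2 hij)), ?_, ?_⟩
  · have e : S = C ((-1) ^ n) * (C ((-1) ^ n) * S.comp (-X)).comp (-X) := by
      rw [mul_comp, C_comp, comp_neg_X_comp_neg_X, ← mul_assoc, ← C_mul, ← mul_pow]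
      simp
    have hc : (C ((-1) ^ n) : ℝ[X]) = ∏ _k : Fin n, C (-1) := by simp
    rw [e, hSη, prod_comp, ← Equiv.prod_comp Fin.revPerm, hc, ← Finset.prod_mul_distrib]
    refine Finset.prod_congr rfl fun k _ => ?_
    simp
    ring
  · exact ⟨by linarith, fun h => by linarith [h1 h], fun h => by linarith [h2 h],
      fun h => by linarith [h3 h]⟩

end Reflection

/-! ### Lowering and raising relations for the Al-Salam–Carlitz I polynomials. -/

section Coefficients

variable {q a : ℝ}

/-- The coefficients of the Al-Salam–Carlitz I polynomials in the basis `∏_{j < k} (x - q^j)`. -/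
noncomputable def asciCoeff (q a : ℝ) (n k : ℕ) : ℝ :=
  (-a) ^ n * q ^ n.choose 2 *
    (qPochhammer (q ^ n)⁻¹ q k / qPochhammer q q k * (a⁻¹ * q) ^ k)

theorem asciPoly_eq_sum (q a : ℝ) (n : ℕ) :
    asciPoly q a n =
      ∑ k ∈ Finset.range (n + 1), C (asciCoeff q a n k) * ∏ j ∈ Finset.range k, (X - C (q ^ j)) := by
  simp only [asciPoly, asciCoeff, Finset.mul_sum, C_mul, mul_assoc]

theorem eval_asciPoly (q a : ℝ) (n : ℕ) (x : ℝ) :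
    (asciPoly q a n).eval x =
      ∑ k ∈ Finset.range (n + 1), asciCoeff q a n k * ∏ j ∈ Finset.range k, (x - q ^ j) := by
  rw [asciPoly_eq_sum]
  simp [eval_finsetSum, eval_prod]

theorem one_sub_pow_succ_ne_zero (hq0 : 0 < q) (hq1 : q < 1) (k : ℕ) : 1 - q ^ (k + 1) ≠ 0 :=
  (sub_pos.2 (pow_lt_one₀ hq0.le hq1 k.succ_ne_zero)).ne'

theorem qPochhammer_self_ne_zero (hq0 : 0 < q) (hq1 : q < 1) (k : ℕ) : qPochhammer q q k ≠ 0 := by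
  rw [qPochhammer, Finset.prod_ne_zero_iff]
  intro j _
  rw [← pow_succ']
  exact one_sub_pow_succ_ne_zero hq0 hq1 j

theorem qPochhammer_succ (c q : ℝ) (k : ℕ) :
    qPochhammer c q (k + 1) = qPochhammer c q k * (1 - c * q ^ k) := Finset.prod_range_succ _ _

theorem qPochhammer_inv_pow_succ (hq : q ≠ 0) (n k : ℕ) :
    qPochhammer (q ^ (n + 1))⁻¹ q (k + 1) =
      (1 - (q ^ (n + 1))⁻¹) * qPochhammer (q ^ n)⁻¹ q k := by
  rw [qPochhammer, Finset.prod_range_succ', mul_comm, pow_zero, mul_one, qPochhammer]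
  congr 1
  refine Finset.prod_congr rfl fun j _ => ?_
  rw [pow_succ q n, pow_succ q j]
  field_simp

theorem asciCoeff_zero_right (q a : ℝ) (n : ℕ) :
    asciCoeff q a n 0 = (-a) ^ n * q ^ n.choose 2 := by
  simp [asciCoeff, qPochhammer]

/-- This is the lowering relation read off on coefficients: the `q`-derivative sends the basis
element of index `k + 1` to `[k+1]_q` times the one of index `k`. -/
theorem asciCoeff_succ_succ (hq0 : 0 < q) (hq1 : q < 1) (ha : a ≠ 0) (n k : ℕ) :
    asciCoeff q a (n + 1) (k + 1) * (1 - q ^ (k + 1)) =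
      (1 - q ^ (n + 1)) * asciCoeff q a n k := by
  have h1 := one_sub_pow_succ_ne_zero hq0 hq1 k
  have h2 := qPochhammer_self_ne_zero hq0 hq1 k
  have h3 : n.succ.choose 2 = n + n.choose 2 := by
    rw [Nat.choose_succ_succ' n 1, Nat.choose_one_right]
  rw [asciCoeff, asciCoeff, qPochhammer_inv_pow_succ hq0.ne', qPochhammer_succ q q k, h3,
    ← pow_succ' q k,
    pow_succ (a⁻¹ * q) k]
  generalize (a⁻¹ * q) ^ k = t
  field_simp
  ring

theorem asciCoeff_succ_right (hq0 : 0 < q) (hq1 : q < 1) (ha : a ≠ 0) (n k : ℕ) :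
    asciCoeff q a n (k + 1) * (a * (q ^ n * (1 - q ^ (k + 1)))) =
      asciCoeff q a n k * (q * (q ^ n - q ^ k)) := by
  have h1 := one_sub_pow_succ_ne_zero hq0 hq1 k
  have h2 := qPochhammer_self_ne_zero hq0 hq1 k
  rw [asciCoeff, asciCoeff, qPochhammer_succ, qPochhammer_succ q q k, ← pow_succ' q k,
    pow_succ (a⁻¹ * q) k]
  generalize (a⁻¹ * q) ^ k = t
  field_simp

theorem asciCoeff_self (hq0 : 0 < q) (hq1 : q < 1) (ha : a ≠ 0) (n : ℕ) :
    asciCoeff q a n n = 1 := by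
  induction n with
  | zero => simp [asciCoeff, qPochhammer]
  | succ n ih =>
    have := asciCoeff_succ_succ hq0 hq1 ha n n
    rw [ih, mul_comm] at this
    exact mul_left_cancel₀ (one_sub_pow_succ_ne_zero hq0 hq1 n) this

/-- `(q^{-n}; q)_{n+1}` contains the factor `1 - q^{-n} q^n`. This lets the coefficient sum be
extended by one term in `asciPoly_raising`. -/
theorem asciCoeff_self_succ (hq0 : 0 < q) (n : ℕ) :
    asciCoeff q a n (n + 1) = 0 := by
  rw [asciCoeff, qPochhammer_succ, inv_mul_cancel₀ (pow_ne_zero _ hq0.ne')]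
  simp

/-- The coefficient recurrence behind the raising relation. -/
theorem asciCoeff_raising (hq0 : 0 < q) (hq1 : q < 1) (ha : a ≠ 0) (n k : ℕ) :
    asciCoeff q a (n + 1) (k + 1) * (q ^ n)⁻¹ =
      asciCoeff q a n k * (q ^ k)⁻¹ - a * (asciCoeff q a n (k + 1) * (q ^ (k + 1))⁻¹) := by
  have h1 := one_sub_pow_succ_ne_zero hq0 hq1 k
  have e1 := asciCoeff_succ_succ hq0 hq1 ha n k
  have e2 := asciCoeff_succ_right hq0 hq1 ha n k
  have hqn := pow_ne_zero n hq0.ne'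
  have hqk := pow_ne_zero k hq0.ne'
  field_simp
  rw [← mul_left_inj' h1]
  simp only [pow_succ] at *
  linear_combination q * (q ^ k) ^ 2 * e1 + q ^ k * e2

theorem asciPoly_monic (hq0 : 0 < q) (hq1 : q < 1) (ha : a ≠ 0) (n : ℕ) :
    (asciPoly q a n).Monic ∧ (asciPoly q a n).natDegree = n := by
  have hd : ∀ k, (∏ j ∈ Finset.range k, (X - C (q ^ j)) : ℝ[X]).degree = k := fun k => by
    rw [degree_prod, Finset.sum_congr rfl fun j _ => degree_X_sub_C (q ^ j)]; simp
  have hm : (∏ j ∈ Finset.range n, (X - C (q ^ j)) : ℝ[X]).Monic := monic_prod_X_sub_C _ _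
  have hlow : (∑ k ∈ Finset.range n, C (asciCoeff q a n k) *
      ∏ j ∈ Finset.range k, (X - C (q ^ j)) : ℝ[X]).degree < n := by
    rw [← mem_degreeLT]
    refine Submodule.sum_mem _ fun k hk => ?_
    rw [mem_degreeLT, ← smul_eq_C_mul]
    refine (degree_smul_le _ _).trans_lt ?_
    rw [hd]
    exact_mod_cast Finset.mem_range.1 hk
  rw [← hd n] at hlow
  rw [asciPoly_eq_sum, Finset.sum_range_succ, asciCoeff_self hq0 hq1 ha, C_1, one_mul]
  refine ⟨hm.add_of_right hlow, ?_⟩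
  rw [natDegree_eq_of_degree_eq (degree_add_eq_right_of_degree_lt hlow)]
  exact natDegree_eq_of_degree_eq_some (hd n)

/-- The lowering relation `D_q U_{n+1} = [n+1]_q U_n`. -/
theorem asciPoly_lowering (hq0 : 0 < q) (hq1 : q < 1) (ha : a ≠ 0) (n : ℕ) (x : ℝ) :
    (asciPoly q a (n + 1)).eval (q * x) - (asciPoly q a (n + 1)).eval x =
      (q ^ (n + 1) - 1) * x * (asciPoly q a n).eval x := by
  rw [eval_asciPoly, eval_asciPoly, eval_asciPoly, ← Finset.sum_sub_distrib,
    Finset.sum_range_succ', Finset.mul_sum]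
  simp only [Finset.range_zero, Finset.prod_empty, sub_self, add_zero]
  refine Finset.sum_congr rfl fun k _ => ?_
  have h : ∏ j ∈ Finset.range (k + 1), (q * x - q ^ j) =
      (q * x - 1) * (q ^ k * ∏ j ∈ Finset.range k, (x - q ^ j)) := by
    rw [Finset.prod_range_succ', mul_comm, pow_zero]
    congr 1
    conv_rhs => rw [← Finset.card_range k, ← Finset.prod_const, Finset.card_range,
      ← Finset.prod_mul_distrib]
    exact Finset.prod_congr rfl fun j _ => by ring
  rw [h, Finset.prod_range_succ]
  have := asciCoeff_succ_succ hq0 hq1 ha n k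
  rw [pow_succ q k] at this
  linear_combination (-x * ∏ j ∈ Finset.range k, (x - q ^ j)) * this

/-- The raising relation. -/
theorem asciPoly_raising (hq0 : 0 < q) (hq1 : q < 1) (ha : a ≠ 0) (n : ℕ) (x : ℝ) :
    (1 - x) * (a - x) * (asciPoly q a n).eval (q⁻¹ * x) - a * (asciPoly q a n).eval x =
      x * ((q ^ n)⁻¹ * (asciPoly q a (n + 1)).eval x) := by
  set φ : ℕ → ℝ := fun k => ∏ j ∈ Finset.range k, (x - q ^ j) with hφ
  -- The raising operator on one basis element: `q^k (x - 1) φ_k(x / q) = φ_{k+1}(x)` turns the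
  -- dilated product into the next basis element.
  have hstep : ∀ k, (1 - x) * (a - x) * ∏ j ∈ Finset.range k, (q⁻¹ * x - q ^ j) - a * φ k =
      x * ((q ^ k)⁻¹ * (φ (k + 1) - a * φ k)) := by
    intro k
    have h1 : q ^ k * ∏ j ∈ Finset.range k, (q⁻¹ * x - q ^ j) =
        ∏ j ∈ Finset.range k, (x - q ^ (j + 1)) := by
      conv_lhs => rw [← Finset.card_range k, ← Finset.prod_const, Finset.card_range,
        ← Finset.prod_mul_distrib]
      refine Finset.prod_congr rfl fun j _ => ?_
      rw [pow_succ]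
      field_simp [hq0.ne']
    have h2 : φ (k + 1) = (∏ j ∈ Finset.range k, (x - q ^ (j + 1))) * (x - 1) := by
      simp only [hφ]
      rw [Finset.prod_range_succ', pow_zero]
    have h3 : φ (k + 1) = φ k * (x - q ^ k) := Finset.prod_range_succ _ _
    have hqk : q ^ k ≠ 0 := pow_ne_zero k hq0.ne'
    rw [← h1] at h2
    rw [← mul_right_inj' hqk, mul_left_comm (q ^ k) x, mul_inv_cancel_left₀ hqk]
    linear_combination (a - x) * h2 - a * h3
  rw [eval_asciPoly, eval_asciPoly, eval_asciPoly, Finset.mul_sum, Finset.mul_sum,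
    ← Finset.sum_sub_distrib]
  have hL : ∀ k, (1 - x) * (a - x) * (asciCoeff q a n k * ∏ j ∈ Finset.range k, (q⁻¹ * x - q ^ j)) -
      a * (asciCoeff q a n k * φ k) =
      x * (asciCoeff q a n k * (q ^ k)⁻¹ * φ (k + 1)) -
        x * (a * (asciCoeff q a n k * (q ^ k)⁻¹) * φ k) := fun k => by
    linear_combination asciCoeff q a n k * hstep k
  rw [Finset.sum_congr rfl fun k _ => hL k, Finset.sum_sub_distrib, ← Finset.mul_sum,
    ← Finset.mul_sum, ← mul_sub]
  congr 1
  -- Shift the index by one: the term at `n + 1` is zero, and the term at `0` is split off to match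
  -- the constant coefficient of the right side.
  have hext : ∑ k ∈ Finset.range (n + 1), a * (asciCoeff q a n k * (q ^ k)⁻¹) * φ k =
      ∑ k ∈ Finset.range (n + 1), a * (asciCoeff q a n (k + 1) * (q ^ (k + 1))⁻¹) * φ (k + 1) +
        a * asciCoeff q a n 0 := by
    have := Finset.sum_range_succ (fun k => a * (asciCoeff q a n k * (q ^ k)⁻¹) * φ k) (n + 1)
    rw [asciCoeff_self_succ hq0] at this
    rw [← sub_eq_zero] at this ⊢
    rw [Finset.sum_range_succ'] at this
    simp only [hφ, Finset.range_zero, Finset.prod_empty, pow_zero, inv_one, mul_one] at this ⊢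
    linear_combination -this
  rw [hext, Finset.sum_range_succ' _ (n + 1), ← sub_sub, ← Finset.sum_sub_distrib, mul_add,
    Finset.mul_sum]
  simp only [Finset.range_zero, Finset.prod_empty, mul_one, sub_eq_add_neg]
  congr 1
  · refine Finset.sum_congr rfl fun k _ => ?_
    linear_combination -φ (k + 1) * asciCoeff_raising hq0 hq1 ha n k
  · have h3 : (n + 1).choose 2 = n + n.choose 2 := by
      rw [Nat.choose_succ_succ' n 1, Nat.choose_one_right]
    rw [asciCoeff_zero_right, asciCoeff_zero_right, h3]
    have hqn := pow_ne_zero n hq0.ne'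
    rw [pow_add q]
    field_simp
    ring

end Coefficients

/-! ### Positivity of the Jackson integral and orthogonality of the polynomials. -/

section Functional

open Filter Topology

variable {q a c τ : ℝ}

theorem multipliable_one_sub_mul_pow (hq0 : 0 < q) (hq1 : q < 1) (c : ℝ) :
    Multipliable fun j : ℕ => 1 - c * q ^ j := by
  have h : Summable fun j : ℕ => -c * q ^ j :=
    (summable_geometric_of_lt_one hq0.le hq1).mul_left _
  simpa [sub_eq_add_neg] using Real.multipliable_one_add_of_summable h

theorem qPochhammerInf_pos (hq0 : 0 < q) (hq1 : q < 1) (hc : c < 1) : 0 < qPochhammerInf c q := by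
  have h : Summable fun j : ℕ => -c * q ^ j :=
    (summable_geometric_of_lt_one hq0.le hq1).mul_left _
  have hpos : ∀ j : ℕ, 0 < 1 + -c * q ^ j := fun j => by
    have h1 : 0 < q ^ j := pow_pos hq0 j
    have h2 : q ^ j ≤ 1 := pow_le_one₀ hq0.le hq1.le
    nlinarith
  have := Real.rexp_tsum_eq_tprod hpos (Real.summable_log_one_add_of_summable h)
  simp only [neg_mul, ← sub_eq_add_neg] at this
  rw [qPochhammerInf, ← this]
  exact Real.exp_pos _

theorem qPochhammer_mul_qPochhammerInf (hq0 : 0 < q) (hq1 : q < 1) (c : ℝ) (m : ℕ) :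
    qPochhammer c q m * qPochhammerInf (c * q ^ m) q = qPochhammerInf c q := by
  induction m with
  | zero => simp [qPochhammer]
  | succ m ih =>
    have h : qPochhammerInf (c * q ^ m) q =
        (1 - c * q ^ m) * qPochhammerInf (c * q ^ (m + 1)) q := by
      have e : (fun j : ℕ => 1 - c * q ^ m * q ^ (j + 1)) =
          fun j : ℕ => 1 - c * q ^ (m + 1) * q ^ j := by
        funext j; ring
      have h1 : Multipliable fun j : ℕ => 1 - c * q ^ m * q ^ (j + 1) := by
        rw [e]; exact multipliable_one_sub_mul_pow hq0 hq1 _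
      have h2 := tprod_eq_zero_mul' (f := fun j : ℕ => 1 - c * q ^ m * q ^ j) h1
      rw [pow_zero, mul_one, e] at h2
      exact h2
    rw [qPochhammer_succ, mul_assoc, ← h, ih]

theorem qPochhammerInf_step (hq0 : 0 < q) (hq1 : q < 1) (c : ℝ) :
    qPochhammerInf c q = (1 - c) * qPochhammerInf (q * c) q := by
  rw [← qPochhammer_mul_qPochhammerInf hq0 hq1 c 1]
  simp [qPochhammer, mul_comm c]

/-- `(c q^m; q)_∞` is the quotient of `(c; q)_∞` by its partial product `(c; q)_m`, and `(c; q)_∞`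
is nonzero. -/
theorem tendsto_qPochhammerInf (hq0 : 0 < q) (hq1 : q < 1) (hc : c < 1) :
    Tendsto (fun m : ℕ => qPochhammerInf (c * q ^ m) q) atTop (𝓝 1) := by
  have hP := qPochhammerInf_pos hq0 hq1 hc
  have h1 : Tendsto (fun m : ℕ => qPochhammer c q m) atTop (𝓝 (qPochhammerInf c q)) :=
    (multipliable_one_sub_mul_pow hq0 hq1 c).hasProd.tendsto_prod_nat
  have h2 := (tendsto_const_nhds (x := qPochhammerInf c q)).div h1 hP.ne'
  rw [div_self hP.ne'] at h2
  refine h2.congr fun m => ?_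
  have h3 := qPochhammer_mul_qPochhammerInf hq0 hq1 c m
  have h4 : qPochhammer c q m ≠ 0 := fun h => by
    rw [h, zero_mul] at h3; exact hP.ne h3
  rw [← h3]
  simp [h4]

/-- The Al-Salam–Carlitz I weight `(q x, a⁻¹ q x; q)_∞`. -/
noncomputable def asciWeight (q a x : ℝ) : ℝ :=
  qPochhammerInf (q * x) q * qPochhammerInf (a⁻¹ * q * x) q

theorem asciWeight_pos (hq0 : 0 < q) (hq1 : q < 1) (h1 : q * τ < 1) (h2 : a⁻¹ * q * τ < 1)
    (m : ℕ) : 0 < asciWeight q a (q ^ m * τ) := by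
  have hm : 0 < q ^ m ∧ q ^ m ≤ 1 := ⟨pow_pos hq0 m, pow_le_one₀ hq0.le hq1.le⟩
  have key : ∀ t : ℝ, t < 1 → q ^ m * t < 1 := fun t ht => by nlinarith
  refine mul_pos (qPochhammerInf_pos hq0 hq1 ?_) (qPochhammerInf_pos hq0 hq1 ?_)
  · rw [mul_left_comm]; exact key _ h1
  · rw [mul_left_comm]; exact key _ h2

theorem asciWeight_step (hq0 : 0 < q) (hq1 : q < 1) (x : ℝ) :
    asciWeight q a x = (1 - q * x) * (1 - a⁻¹ * (q * x)) * asciWeight q a (q * x) := by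
  rw [asciWeight, qPochhammerInf_step hq0 hq1 (q * x), qPochhammerInf_step hq0 hq1 (a⁻¹ * q * x),
    asciWeight, show q * (a⁻¹ * q * x) = a⁻¹ * q * (q * x) by ring]
  ring

theorem tendsto_asciWeight (hq0 : 0 < q) (hq1 : q < 1) (h1 : q * τ < 1) (h2 : a⁻¹ * q * τ < 1) :
    Tendsto (fun m : ℕ => asciWeight q a (q ^ m * τ)) atTop (𝓝 1) := by
  have := (tendsto_qPochhammerInf hq0 hq1 h1).mul (tendsto_qPochhammerInf hq0 hq1 h2)
  rw [mul_one] at this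
  refine this.congr fun m => ?_
  rw [asciWeight, mul_comm (q ^ m) τ, ← mul_assoc, ← mul_assoc]

theorem tendsto_eval_pow_mul (hq0 : 0 < q) (hq1 : q < 1) (p : ℝ[X]) (τ : ℝ) :
    Tendsto (fun m : ℕ => p.eval (q ^ m * τ)) atTop (𝓝 (p.eval 0)) := by
  refine (p.continuous.tendsto 0).comp ?_
  simpa using (tendsto_pow_atTop_nhds_zero_of_lt_one hq0.le hq1).mul_const τ

/-- The polynomial and the weight both converge along the lattice, so the terms are dominated by the
geometric series in `q`. -/
theorem summable_asci (hq0 : 0 < q) (hq1 : q < 1) (h1 : q * τ < 1) (h2 : a⁻¹ * q * τ < 1)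
    (p : ℝ[X]) :
    Summable fun m : ℕ => p.eval (q ^ m * τ) * asciWeight q a (q ^ m * τ) * q ^ m := by
  have h := ((tendsto_eval_pow_mul hq0 hq1 p τ).mul
    (tendsto_asciWeight hq0 hq1 h1 h2)).isBigO_one ℝ
  have h3 := h.mul (Asymptotics.isBigO_refl (fun m : ℕ => q ^ m) atTop)
  simp only [one_mul] at h3
  exact summable_of_isBigO_nat (summable_geometric_of_lt_one hq0.le hq1) h3

/-- The series of a polynomial against the weight along the lattice `τ q^m`. -/
noncomputable def asciSeries (q a τ : ℝ) (p : ℝ[X]) : ℝ :=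
  ∑' m : ℕ, p.eval (q ^ m * τ) * asciWeight q a (q ^ m * τ) * q ^ m

theorem asciFunctional_eq (q a : ℝ) (p : ℝ[X]) :
    asciFunctional q a p =
      (1 - q) * asciSeries q a 1 p + -a * (1 - q) * asciSeries q a a p := by
  simp only [asciFunctional, jacksonIntegral, jacksonIntegralZero, asciSeries, asciWeight]
  ring

theorem asciSeries_add (hq0 : 0 < q) (hq1 : q < 1) (h1 : q * τ < 1) (h2 : a⁻¹ * q * τ < 1)
    (p r : ℝ[X]) : asciSeries q a τ (p + r) = asciSeries q a τ p + asciSeries q a τ r := by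
  rw [asciSeries, asciSeries, asciSeries, ← (summable_asci hq0 hq1 h1 h2 p).tsum_add
    (summable_asci hq0 hq1 h1 h2 r)]
  simp [add_mul]

theorem asciSeries_smul (q a τ c : ℝ) (p : ℝ[X]) :
    asciSeries q a τ (c • p) = c * asciSeries q a τ p := by
  rw [asciSeries, asciSeries, ← tsum_mul_left]
  simp [mul_assoc]

theorem asciSeries_nonneg (hq0 : 0 < q) (hq1 : q < 1) (h1 : q * τ < 1) (h2 : a⁻¹ * q * τ < 1)
    {p : ℝ[X]} (hp : ∀ m : ℕ, 0 ≤ p.eval (τ * q ^ m)) : 0 ≤ asciSeries q a τ p :=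
  tsum_nonneg fun m => mul_nonneg (mul_nonneg (by rw [mul_comm]; exact hp m)
    (asciWeight_pos hq0 hq1 h1 h2 m).le) (pow_pos hq0 m).le

theorem asciSeries_pos (hq0 : 0 < q) (hq1 : q < 1) (h1 : q * τ < 1) (h2 : a⁻¹ * q * τ < 1)
    (hτ : τ ≠ 0) {p : ℝ[X]} (hp0 : p ≠ 0) (hp : ∀ m : ℕ, 0 ≤ p.eval (τ * q ^ m)) :
    0 < asciSeries q a τ p := by
  obtain ⟨m, hm⟩ : ∃ m : ℕ, p.eval (q ^ m * τ) ≠ 0 := by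
    by_contra! h
    refine hp0 (eq_zero_of_infinite_isRoot p ?_)
    refine (Set.infinite_range_of_injective (f := fun m : ℕ => q ^ m * τ) ?_).mono ?_
    · intro i j hij
      exact (pow_right_strictAnti₀ hq0 hq1).injective (mul_right_cancel₀ hτ hij)
    · rintro _ ⟨m, rfl⟩
      exact h m
  refine (summable_asci hq0 hq1 h1 h2 p).tsum_pos (fun m => ?_) m ?_
  · exact mul_nonneg (mul_nonneg (by rw [mul_comm]; exact hp m)
      (asciWeight_pos hq0 hq1 h1 h2 m).le) (pow_pos hq0 m).le
  · refine mul_pos (mul_pos (lt_of_le_of_ne ?_ hm.symm)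
      (asciWeight_pos hq0 hq1 h1 h2 m)) (pow_pos hq0 m)
    rw [mul_comm]; exact hp m

/-- The discrete fundamental theorem of calculus for the weight: the Pearson equation. -/
theorem asciSeries_pearson (hq0 : 0 < q) (hq1 : q < 1) (ha : a ≠ 0) (h1 : q * τ < 1)
    (h2 : a⁻¹ * q * τ < 1) (hτ : (1 - τ) * (a - τ) = 0) {f h : ℝ[X]}
    (hfh : ∀ x, (1 - x) * (a - x) * f.eval x - a * f.eval (q * x) = x * h.eval x) :
    τ * asciSeries q a τ h = -(a * f.eval 0) := by
  -- The series telescopes through `F`. It starts at zero because `τ` is a root of `(1 - x)(a - x)`,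
  -- and its limit `a f(0)` does not depend on `τ`.
  set F : ℕ → ℝ := fun m => f.eval (q ^ m * τ) *
    ((1 - q ^ m * τ) * (a - q ^ m * τ) * asciWeight q a (q ^ m * τ)) with hF
  have hsucc : ∀ m, F (m + 1) = a * f.eval (q * (q ^ m * τ)) * asciWeight q a (q ^ m * τ) := by
    intro m
    simp only [hF]
    rw [asciWeight_step hq0 hq1 (q ^ m * τ), pow_succ', mul_assoc q]
    field_simp
  have hdiff : ∀ m, F m - F (m + 1) =
      τ * (h.eval (q ^ m * τ) * asciWeight q a (q ^ m * τ) * q ^ m) := by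
    intro m
    rw [hsucc]
    simp only [hF]
    linear_combination asciWeight q a (q ^ m * τ) * hfh (q ^ m * τ)
  have hF0 : F 0 = 0 := by
    simp only [hF, pow_zero, one_mul, hτ, zero_mul, mul_zero]
  have hlim : Tendsto F atTop (𝓝 (a * f.eval 0)) := by
    have hz : Tendsto (fun m : ℕ => q ^ m * τ) atTop (𝓝 0) := by
      simpa using (tendsto_pow_atTop_nhds_zero_of_lt_one hq0.le hq1).mul_const τ
    have := (tendsto_eval_pow_mul hq0 hq1 f τ).mul
      (((hz.const_sub 1).mul (hz.const_sub a)).mul (tendsto_asciWeight hq0 hq1 h1 h2))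
    rw [show f.eval 0 * ((1 - 0) * (a - 0) * 1) = a * f.eval 0 by ring] at this
    exact this
  have hs := ((summable_asci hq0 hq1 h1 h2 h).mul_left τ).hasSum.tendsto_sum_nat
  simp only [← hdiff, Finset.sum_range_sub', hF0, zero_sub] at hs
  rw [asciSeries, ← tsum_mul_left]
  simp only [← hdiff]
  exact tendsto_nhds_unique hs hlim.neg

theorem asci_endpoint_bounds (hq0 : 0 < q) (hq1 : q < 1) (ha : a < 0) :
    (q * 1 < 1 ∧ a⁻¹ * q * 1 < 1) ∧ (q * a < 1 ∧ a⁻¹ * q * a < 1) := by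
  have h : a⁻¹ < 0 := inv_lt_zero.2 ha
  refine ⟨⟨by linarith, by nlinarith⟩, by nlinarith, ?_⟩
  rw [mul_right_comm, inv_mul_cancel₀ ha.ne, one_mul]
  exact hq1

/-- The Al-Salam–Carlitz I functional as a linear map. -/
noncomputable def asciLinear (q a : ℝ) (hq0 : 0 < q) (hq1 : q < 1) (ha : a < 0) :
    ℝ[X] →ₗ[ℝ] ℝ where
  toFun := asciFunctional q a
  map_add' p r := by
    obtain ⟨⟨h1, h2⟩, h3, h4⟩ := asci_endpoint_bounds hq0 hq1 ha
    simp only [asciFunctional_eq, asciSeries_add hq0 hq1 h1 h2, asciSeries_add hq0 hq1 h3 h4]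
    ring
  map_smul' c p := by
    simp only [asciFunctional_eq, asciSeries_smul, smul_eq_mul, RingHom.id_apply]
    ring

theorem asciLinear_apply (hq0 : 0 < q) (hq1 : q < 1) (ha : a < 0) (p : ℝ[X]) :
    asciLinear q a hq0 hq1 ha p = asciFunctional q a p := rfl

theorem asciLinear_positive (hq0 : 0 < q) (hq1 : q < 1) (ha : a < 0) :
    PositiveOnLattice q a 1 (asciLinear q a hq0 hq1 ha) := by
  intro p hp h1 h2
  obtain ⟨⟨e1, e2⟩, e3, e4⟩ := asci_endpoint_bounds hq0 hq1 ha
  rw [asciLinear_apply, asciFunctional_eq]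
  have := asciSeries_pos hq0 hq1 e1 e2 one_ne_zero hp h2
  have := asciSeries_nonneg hq0 hq1 e3 e4 h1
  have : 0 < 1 - q := sub_pos.2 hq1
  have : 0 < -a := neg_pos.2 ha
  positivity

/-- The telescoped series from the two end points leave the same boundary value `-a f(0)`, which
cancels in the integral from `a` to `1`. -/
theorem asciLinear_pearson (hq0 : 0 < q) (hq1 : q < 1) (ha : a < 0) {f h : ℝ[X]}
    (hfh : ∀ x, (1 - x) * (a - x) * f.eval x - a * f.eval (q * x) = x * h.eval x) :
    asciLinear q a hq0 hq1 ha h = 0 := by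
  obtain ⟨⟨e1, e2⟩, e3, e4⟩ := asci_endpoint_bounds hq0 hq1 ha
  have k1 := asciSeries_pearson hq0 hq1 ha.ne e1 e2 (by ring) hfh
  have k2 := asciSeries_pearson hq0 hq1 ha.ne e3 e4 (by ring) hfh
  rw [asciLinear_apply, asciFunctional_eq]
  linear_combination (1 - q) * (k1 - k2)

/-- `g(q x) - g(x)` vanishes at the origin, so it is divisible by `X`, and the division lowers the
degree by one. -/
theorem exists_qDiff (hq : q ≠ 1) (g : ℝ[X]) {n : ℕ} (hg : g.degree < (n + 1 : ℕ)) :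
    ∃ d : ℝ[X], d.degree < n ∧ ∀ x, g.eval (q * x) - g.eval x = (q - 1) * x * d.eval x := by
  set r := g.comp (C q * X) - g with hr
  have hr0 : r.coeff 0 = 0 := by simp [hr, coeff_zero_eq_eval_zero, eval_comp]
  have hrd : r.natDegree ≤ n := by
    have hgn : g.natDegree ≤ n := natDegree_le_iff_degree_le.2 (by
      rcases eq_or_ne g 0 with rfl | h0
      · simp
      · rw [degree_eq_natDegree h0] at hg ⊢
        have : g.natDegree < n + 1 := by exact_mod_cast hg
        exact_mod_cast Nat.lt_succ_iff.1 this)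
    refine (natDegree_sub_le _ _).trans (max_le ?_ hgn)
    refine natDegree_comp_le.trans ?_
    refine (Nat.mul_le_mul_left _ ((natDegree_C_mul_le q X).trans natDegree_X_le)).trans ?_
    rwa [mul_one]
  refine ⟨C (q - 1)⁻¹ * r.divX, ?_, fun x => ?_⟩
  · rw [← smul_eq_C_mul]
    refine (degree_smul_le _ _).trans_lt ?_
    rcases eq_or_ne r.divX 0 with h0 | h0
    · rw [h0, degree_zero]; exact WithBot.bot_lt_coe _
    · have hne : r.natDegree ≠ 0 := fun h => h0 (divX_eq_zero_iff.2 (eq_C_of_natDegree_eq_zero h))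
      rw [degree_eq_natDegree h0, natDegree_divX_eq_natDegree_tsub_one]
      exact_mod_cast (by omega : r.natDegree - 1 < n)
  · have h := congrArg (eval x) (divX_mul_X_add r)
    rw [hr0] at h
    have : q - 1 ≠ 0 := sub_ne_zero.2 hq
    simp only [eval_add, eval_mul, eval_X, eval_C] at h ⊢
    have e : r.eval x = g.eval (q * x) - g.eval x := by simp [hr, eval_comp]
    rw [← e, ← h]
    field_simp
    ring

/-- Orthogonality of the Al-Salam–Carlitz I polynomials. -/
theorem asciPoly_isMonicOrthogonal (hq0 : 0 < q) (hq1 : q < 1) (ha : a < 0) (n : ℕ) :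
    IsMonicOrthogonal (asciLinear q a hq0 hq1 ha) n (asciPoly q a n) := by
  obtain ⟨hm, hd⟩ := asciPoly_monic hq0 hq1 ha.ne n
  refine ⟨hm, hd, ?_⟩
  clear hm hd
  induction n with
  | zero =>
    intro p hp
    have : p = 0 := by simpa using hp
    simp [this]
  | succ n ih =>
    intro p hp
    obtain ⟨d, hd, hpd⟩ := exists_qDiff hq1.ne p hp
    -- Summation by parts: with `f = U_n(x / q) p(x)`, the raising relation turns the Pearson
    -- equation into `q^{-n} L (U_{n+1} p) = a (q - 1) L (U_n d)`, where `d` is the `q`-derivative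
    -- of `p`. The right side vanishes by induction.
    have key := asciLinear_pearson hq0 hq1 ha
      (f := (asciPoly q a n).comp (C q⁻¹ * X) * p)
      (h := (q ^ n)⁻¹ • (asciPoly q a (n + 1) * p) - (a * (q - 1)) • (asciPoly q a n * d)) ?_
    · rw [map_sub, map_smul, map_smul, ih d hd, smul_zero, sub_zero, smul_eq_mul] at key
      exact (mul_eq_zero.1 key).resolve_left (inv_ne_zero (pow_ne_zero _ hq0.ne'))
    · intro x
      have h1 := asciPoly_raising hq0 hq1 ha.ne n x
      simp only [eval_mul, eval_comp, eval_C, eval_X, eval_sub, eval_smul, smul_eq_mul,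
        inv_mul_cancel_left₀ hq0.ne']
      linear_combination p.eval x * h1 - a * (asciPoly q a n).eval x * hpd x

end Functional

/-! ### The kernel polynomials and the threshold for the Al-Salam–Carlitz I functional. -/

section Kernel

variable {q a α : ℝ}

theorem qDeriv_eval_eq_qSlope (hq : q ≠ 1) (hα : α ≠ 0) (p : ℝ[X]) :
    qDeriv q (fun t => p.eval t) α = qSlope q α p := by
  rw [qDeriv, if_pos ⟨hα, hq⟩, qSlope_apply]

theorem asciSobolevInner_eq (hq0 : 0 < q) (hq1 : q < 1) (ha : a < 0) (hα : α ≠ 0) (N : ℝ)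
    (f g : ℝ[X]) : asciSobolevInner q a α N f g =
      asciLinear q a hq0 hq1 ha (f * g) + N * qSlope q α f * qSlope q α g := by
  rw [asciSobolevInner, qDeriv_eval_eq_qSlope hq1.ne hα, qDeriv_eval_eq_qSlope hq1.ne hα,
    asciLinear_apply]

theorem isASCISobolevPoly_iff (hq0 : 0 < q) (hq1 : q < 1) (ha : a < 0) (hα : α ≠ 0) (N : ℝ)
    (n : ℕ) (S : ℝ[X]) : IsASCISobolevPoly q a α N n S ↔
      IsSobolevOrthogonal q α (asciLinear q a hq0 hq1 ha) N n S := by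
  simp only [IsASCISobolevPoly, IsSobolevOrthogonal, asciSobolevInner_eq hq0 hq1 ha hα]

/-- The polynomial `K^{(0,1)}(·, α)`. -/
noncomputable def asciSlopeKernel (q a α : ℝ) (n : ℕ) : ℝ[X] :=
  ∑ k ∈ Finset.range n,
    C (qSlope q α (asciPoly q a k) / asciFunctional q a (asciPoly q a k ^ 2)) * asciPoly q a k

theorem asciKernel_zero_one (hq : q ≠ 1) (hα : α ≠ 0) (n : ℕ) (x : ℝ) :
    asciKernel q a n 0 1 x α = (asciSlopeKernel q a α n).eval x := by
  rw [asciKernel, asciSlopeKernel, eval_finsetSum]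
  refine Finset.sum_congr rfl fun k _ => ?_
  rw [Function.iterate_zero, Function.iterate_one, qDeriv_eval_eq_qSlope hq hα, eval_mul, eval_C,
    id]
  ring

theorem asciKernel_one_one (hq : q ≠ 1) (hα : α ≠ 0) (n : ℕ) :
    asciKernel q a n 1 1 α α = qSlope q α (asciSlopeKernel q a α n) := by
  rw [asciKernel, asciSlopeKernel, map_sum]
  refine Finset.sum_congr rfl fun k _ => ?_
  rw [Function.iterate_one, qDeriv_eval_eq_qSlope hq hα, qSlope_C_mul]
  ring

/-- Induction on `n`: the new summand is orthogonal to lower degrees and reproduces the slope on the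
component of `p` along `U_n`, while the old kernel is orthogonal to `U_n`. -/
theorem asciSlopeKernel_isSlopeKernel (hq0 : 0 < q) (hq1 : q < 1) (ha : a < 0) (n : ℕ) :
    IsSlopeKernel q α (asciLinear q a hq0 hq1 ha) n (asciSlopeKernel q a α n) := by
  induction n with
  | zero =>
    refine ⟨by simp [asciSlopeKernel], fun p hp => ?_⟩
    have : p = 0 := by simpa using hp
    simp [this]
  | succ n ih =>
    set L := asciLinear q a hq0 hq1 ha with hL
    set U := asciPoly q a n with hU
    have hUo : IsMonicOrthogonal L n U := asciPoly_isMonicOrthogonal hq0 hq1 ha n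
    have hUd : U.degree = n := by rw [degree_eq_natDegree hUo.1.ne_zero, hUo.2.1]
    have hlt : (n : WithBot ℕ) < (n + 1 : ℕ) := by exact_mod_cast n.lt_succ_self
    have hnorm : 0 < L (U * U) := (asciLinear_positive hq0 hq1 ha).sq_pos hUo.1.ne_zero
    have hQ : asciSlopeKernel q a α (n + 1) =
        asciSlopeKernel q a α n + (qSlope q α U / L (U * U)) • U := by
      rw [asciSlopeKernel, Finset.sum_range_succ, smul_eq_C_mul, hL, asciLinear_apply, ← sq]
      rfl
    rw [hQ]
    refine ⟨(degree_add_le _ _).trans_lt (max_lt (ih.1.trans hlt)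
      ((degree_smul_le _ _).trans_lt (by rwa [hUd]))), fun p hp => ?_⟩
    -- Since `U` is monic of degree `n`, subtracting this multiple cancels the coefficient of `X^n`.
    set r := p - p.coeff n • U with hr
    have hrd : r.degree < n := by
      rw [degree_lt_iff_coeff_zero] at hp ⊢
      intro m hm
      rw [hr, coeff_sub, coeff_smul, smul_eq_mul]
      rcases hm.eq_or_lt with rfl | hm
      · have : U.coeff n = 1 := by
          have := hUo.1.coeff_natDegree; rwa [hUo.2.1] at this
        rw [this]; ring
      · rw [hp m hm, coeff_eq_zero_of_degree_lt (p := U) (by rw [hUd]; exact_mod_cast hm)]; ring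
    have hp' : p = r + p.coeff n • U := by rw [hr]; ring
    have e1 : L (asciSlopeKernel q a α n * U) = 0 := by rw [mul_comm]; exact hUo.2.2 _ ih.1
    rw [hp', add_mul, mul_add, mul_add, smul_mul_assoc, smul_mul_assoc, mul_smul_comm,
      mul_smul_comm]
    simp only [map_add, map_smul, smul_eq_mul, ih.2 r hrd, e1, hUo.2.2 r hrd]
    field_simp
    ring

theorem qSlope_asciPoly (hq0 : 0 < q) (hq1 : q < 1) (ha : a < 0) (hα : α ≠ 0) {n : ℕ}
    (hn : n ≠ 0) :
    qSlope q α (asciPoly q a n) = qNumber q n * (asciPoly q a (n - 1)).eval α := by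
  obtain ⟨m, rfl⟩ := Nat.exists_eq_succ_of_ne_zero hn
  have h1 : q - 1 ≠ 0 := sub_ne_zero.2 hq1.ne
  have h2 : 1 - q ≠ 0 := (sub_pos.2 hq1).ne'
  rw [qSlope_apply, Nat.succ_eq_add_one, asciPoly_lowering hq0 hq1 ha.ne, qNumber,
    Nat.add_sub_cancel]
  field_simp
  ring

theorem asciThreshold_eq_criticalMass (hq0 : 0 < q) (hq1 : q < 1) (ha : a < 0) (hα : α ≠ 0)
    {n : ℕ} (hn : n ≠ 0) (τ : ℝ) : asciThreshold q a α n τ =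
      criticalMass q α (asciPoly q a n) (asciSlopeKernel q a α n) τ := by
  rw [asciThreshold, criticalMass, asciKernel_zero_one hq1.ne hα, asciKernel_one_one hq1.ne hα,
    qSlope_asciPoly hq0 hq1 ha hα hn]

theorem existsUnique_isASCISobolevPoly (hq0 : 0 < q) (hq1 : q < 1) (ha : a < 0) (hα : α ≠ 0)
    (n : ℕ) {N : ℝ} (hN : 0 ≤ N) : ∃! S : ℝ[X], IsASCISobolevPoly q a α N n S := by
  simp only [isASCISobolevPoly_iff hq0 hq1 ha hα]
  exact existsUnique_isSobolevOrthogonal (asciLinear_positive hq0 hq1 ha)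
    (asciPoly_isMonicOrthogonal hq0 hq1 ha n) (asciSlopeKernel_isSlopeKernel hq0 hq1 ha n) hN

end Kernel

/-! ### The two end-point cases for the Al-Salam–Carlitz I polynomials. -/

theorem corollary2 (q a α : ℝ) (hq0 : 0 < q) (hq1 : q < 1) (ha : a < 0)
    (n : ℕ) (hn : 2 ≤ n) :
    (α < a →
      0 < asciThreshold q a α n a ∧
      ∀ N : ℝ, 0 ≤ N →
        (∃! S : Polynomial ℝ, IsASCISobolevPoly q a α N n S) ∧
        ∀ S : Polynomial ℝ, IsASCISobolevPoly q a α N n S →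
          ∃ η : Fin n → ℝ, StrictMono η ∧
            S = ∏ k : Fin n, (Polynomial.X - Polynomial.C (η k)) ∧
            (N < asciThreshold q a α n a →
              a < η ⟨0, by omega⟩ ∧ η ⟨0, by omega⟩ < 1) ∧
            (N = asciThreshold q a α n a → η ⟨0, by omega⟩ = a) ∧
            (asciThreshold q a α n a < N → η ⟨0, by omega⟩ < a)) ∧
    (1 < α →
      0 < asciThreshold q a α n 1 ∧
      ∀ N : ℝ, 0 ≤ N →
        (∃! S : Polynomial ℝ, IsASCISobolevPoly q a α N n S) ∧
        ∀ S : Polynomial ℝ, IsASCISobolevPoly q a α N n S →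
          ∃ η : Fin n → ℝ, StrictMono η ∧
            S = ∏ k : Fin n, (Polynomial.X - Polynomial.C (η k)) ∧
            (N < asciThreshold q a α n 1 →
              a < η ⟨n - 1, by omega⟩ ∧ η ⟨n - 1, by omega⟩ < 1) ∧
            (N = asciThreshold q a α n 1 → η ⟨n - 1, by omega⟩ = 1) ∧
            (asciThreshold q a α n 1 < N → 1 < η ⟨n - 1, by omega⟩)) := by
  have hL := asciLinear_positive hq0 hq1 ha
  have hU := asciPoly_isMonicOrthogonal hq0 hq1 ha n
  have hQ : IsSlopeKernel q α _ n _ := asciSlopeKernel_isSlopeKernel hq0 hq1 ha n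
  have hn0 : n ≠ 0 := by omega
  refine ⟨fun hα => ?_, fun hα => ?_⟩
  · have hα0 : α ≠ 0 := (hα.trans ha).ne
    rw [asciThreshold_eq_criticalMass hq0 hq1 ha hα0 hn0]
    obtain ⟨hT, h⟩ := hQ.smallest_zero hq0 hq1 ha one_pos hα hL hU hn
      (l := ⟨0, by omega⟩) rfl
    refine ⟨hT, fun N hN => ⟨existsUnique_isASCISobolevPoly hq0 hq1 ha hα0 n hN, fun S hS => ?_⟩⟩
    obtain ⟨η, hη, hSη, h0, h1, h2, h3⟩ :=
      h N S hN ((isASCISobolevPoly_iff hq0 hq1 ha hα0 N n S).1 hS)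
    exact ⟨η, hη, hSη, fun hN => ⟨h1 hN, h0⟩, h2, h3⟩
  · have hα0 : α ≠ 0 := (one_pos.trans hα).ne'
    rw [asciThreshold_eq_criticalMass hq0 hq1 ha hα0 hn0]
    obtain ⟨hT, h⟩ := hQ.largest_zero hq0 hq1 ha one_pos hα hL hU hn
      (l := ⟨n - 1, by omega⟩) (Nat.sub_add_cancel (by omega))
    refine ⟨hT, fun N hN => ⟨existsUnique_isASCISobolevPoly hq0 hq1 ha hα0 n hN, fun S hS => ?_⟩⟩
    obtain ⟨η, hη, hSη, h0, h1, h2, h3⟩ :=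
      h N S hN ((isASCISobolevPoly_iff hq0 hq1 ha hα0 N n S).1 hS)
    exact ⟨η, hη, hSη, fun hN => ⟨h0, h1 hN⟩, h2, h3⟩
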